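/- Let $\tau\colon Q\to\mathbb R$ be a smooth fibre bundle with $m$-dimensional typical fibre ($Q$ Hausdorff and second countable), with bundle coordinates $(t,q^i)$, vertical tangent bundle $VQ$, first jet bundle $J^1Q$, and vertical cotangent (Legendre) bundle $V^*Q$ with holonomic coordinates $(t,q^i,p_i)$. Let $$\mathcal L=\tfrac12 a_{ij}q^i_tq^j_t+b_iq^i_t+c$$ be a smooth quadratic Lagrangian function on $J^1Q$, where $a_{ij}=a_{ji}$, $b_i$, $c$ are local smooth functions on $Q$ and the matrix $a$ has constant rank. Let $N_L\subset V^*Q$ be the Lagrangian constraint space, i.e. the image of the Legendre map $p_i=\partial\mathcal L/\partial q^i_t$, and assume that it contains the zero section of $V^*Q\to Q$. Let $\sigma_0\colon V^*Q\to VQ$, $\dot q^j=\sigma_0^{jk}p_k$, be a smooth symmetric linear bundle map over $Q$ with $a\sigma_0a=a$ and $\sigma_0a\sigma_0=\sigma_0$; then $N_L$ is given by the (in general reducible) constraints $R_i=p_i-a_{ij}\sigma_0^{jk}p_k=0$. Let $\mathcal A(V^*Q)=\bigoplus_{k\ge0}\mathcal N^k$ be the graded commutative algebra of BRST functions: locally,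 over bundle coordinates of $Q$, its elements are finite sums of products of antighosts $c^{(k)}_i$ ($k=1,2,\dots$) with coefficients which are smooth functions on $V^*Q$. The antighost $c^{(k)}_i$ has antighost number $k$ and Grassmann parity $k \bmod 2$, and for each $k$ the $c_i^{(k)}$ have the same transformation law as the $p_i$; $\mathcal N^k$ is the module of BRST functions of antighost number $k$, and $\mathcal N^0=C^\infty(V^*Q)$. Then there is a graded derivation $\delta$ of $\mathcal A(V^*Q)$, i.e. $\delta(fg)=\delta(f)g+(-1)^kf\,\delta(g)$ for $f\in\mathcal N^k$, which vanishes on $C^\infty(V^*Q)$ and is given on the antighosts by $$\delta(c^{(1)}_i)=(\delta_i^k-a_{ij}\sigma_0^{jk})p_k=R_i,\qquad \delta(c^{(2r)}_i)=a_{ij}\sigma_0^{jk}c^{(2r-1)}_k,\qquad \delta(c^{(2r+1)}_i)=(\delta_i^k-a_{ij}\sigma_0^{jk})c^{(2r)}_k\qquad(r\ge1).$$ It satisfies $\delta\circ\delta=0$ and $\delta(\mathcal N^{k+1})\subset\mathcal N^k$, and the complex $$0\longleftarrow C^\infty(V^*Q)\longleftarrow\mathcal N^1\longleftarrow\mathcal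 N^2\longleftarrow\cdots$$ is a Koszul–Tate resolution: $H_k=0$ for all $k\ge1$, and $$H_0=C^\infty(V^*Q)/I_{N}\cong C^\infty(N_L),$$ where $I_{N}$ is the ideal of smooth functions on $V^*Q$ which vanish on $N_L$; the isomorphisms are induced by the identification $\mathcal N^0=C^\infty(V^*Q)$ and by restriction of functions to $N_L$. -/

import Mathlib

open Set Filter Topology
open scoped Manifold ContDiff

noncomputable section

namespace KoszulTate

/-! ## The fibre superalgebra of antighosts -/

section Fibre

variable (W : Type*) [AddCommGroup W] [Module ℝ W]

/-- The element `w` of the copy number `k + 1` of `W` in the tensor algebra of the direct sum of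
countably many copies of `W`. The copies are numbered `1, 2, 3, …` by the antighost number, so the
index `k : ℕ` stands for the antighost number `k + 1`. -/
def preGen (k : ℕ) (w : W) : TensorAlgebra ℝ (DirectSum ℕ fun _ => W) :=
  TensorAlgebra.ι ℝ (DirectSum.lof ℝ ℕ (fun _ => W) k w)

/-- Graded commutativity of the generators: odd generators anticommute, all other pairs of
generators commute. -/
inductive SuperRel : TensorAlgebra ℝ (DirectSum ℕ fun _ => W) →
    TensorAlgebra ℝ (DirectSum ℕ fun _ => W) → Prop
  | comm (k l : ℕ) (v w : W) :
      SuperRel (preGen W k v * preGen W l w)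
        ((-1 : ℝ) ^ ((k + 1) * (l + 1)) • (preGen W l w * preGen W k v))

/-- The graded commutative algebra generated by countably many copies of `W` in the degrees
`1, 2, 3, …`, those in even degree being even and those in odd degree being odd. -/
def Antighost : Type _ := RingQuot (SuperRel W)

instance : Ring (Antighost W) := inferInstanceAs (Ring (RingQuot (SuperRel W)))

instance : Algebra ℝ (Antighost W) := inferInstanceAs (Algebra ℝ (RingQuot (SuperRel W)))

variable {W}

/-- The quotient map from the tensor algebra. -/
def mk : TensorAlgebra ℝ (DirectSum ℕ fun _ => W) →ₐ[ℝ] Antighost W :=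
  RingQuot.mkAlgHom ℝ (SuperRel W)

theorem mk_surjective : Function.Surjective (mk (W := W)) :=
  RingQuot.mkAlgHom_surjective ℝ (SuperRel W)

/-- The generator `c^{(k+1)}(w)`, of antighost number `k + 1`. -/
def gen (k : ℕ) : W →ₗ[ℝ] Antighost W :=
  mk.toLinearMap ∘ₗ TensorAlgebra.ι ℝ ∘ₗ
    DirectSum.lof ℝ ℕ (fun _ => W) k

theorem mk_preGen (k : ℕ) (w : W) :
    mk (preGen W k w) = gen k w := rfl

theorem gen_comm (k l : ℕ) (v w : W) :
    gen k v * gen l w = (-1 : ℝ) ^ ((k + 1) * (l + 1)) • (gen l w * gen k v) := by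
  have h : mk _ = mk _ := RingQuot.mkAlgHom_rel ℝ (SuperRel.comm k l v w)
  simpa [mk_preGen] using h

section Lift

variable {B : Type*} [Semiring B] [Algebra ℝ B]

/-- The universal property of the graded commutative algebra. -/
def lift (F : ℕ → W →ₗ[ℝ] B)
    (hF : ∀ k l v w, F k v * F l w = (-1 : ℝ) ^ ((k + 1) * (l + 1)) • (F l w * F k v)) :
    Antighost W →ₐ[ℝ] B :=
  RingQuot.liftAlgHom ℝ ⟨TensorAlgebra.lift ℝ (DirectSum.toModule ℝ ℕ B F), by
    rintro _ _ ⟨k, l, v, w⟩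
    simp [preGen, hF k l v w]⟩

theorem lift_gen (F : ℕ → W →ₗ[ℝ] B)
    (hF : ∀ k l v w, F k v * F l w = (-1 : ℝ) ^ ((k + 1) * (l + 1)) • (F l w * F k v))
    (k : ℕ) (w : W) : lift F hF (gen k w) = F k w := by
  rw [← mk_preGen]
  refine (RingQuot.liftAlgHom_mkAlgHom_apply ℝ _ _ _).trans ?_
  simp [preGen]

theorem hom_ext {f g : Antighost W →ₐ[ℝ] B} (h : ∀ k w, f (gen k w) = g (gen k w)) : f = g := by
  apply RingQuot.ringQuot_ext'
  apply TensorAlgebra.hom_ext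
  apply DirectSum.linearMap_ext
  intro k
  ext w
  exact h k w

end Lift

/-- The parity automorphism, which is `(-1)^k` on elements of antighost number `k`. -/
def parity : Antighost W →ₐ[ℝ] Antighost W :=
  lift (fun k => (-1 : ℝ) ^ (k + 1) • gen k) (by
    intro k l v w
    simp only [LinearMap.smul_apply, smul_mul_smul_comm, gen_comm k l v w, smul_smul]
    congr 1
    ring)

theorem parity_gen (k : ℕ) (w : W) : parity (gen k w) = (-1 : ℝ) ^ (k + 1) • gen k w := by
  simp [parity, lift_gen]

/-- The values of the Koszul–Tate differential on generators, for a linear form `p` and an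
endomorphism `T` of `W`:
`c^{(1)}(w) ↦ p (w - T w)`, `c^{(2r)}(w) ↦ c^{(2r-1)}(T w)`,
`c^{(2r+1)}(w) ↦ c^{(2r)}(w - T w)`, where `r ≥ 1`. -/
def deltaGen (T : W →ₗ[ℝ] W) (p : Module.Dual ℝ W) : ℕ → W →ₗ[ℝ] Antighost W
  | 0 => Algebra.linearMap ℝ (Antighost W) ∘ₗ p ∘ₗ (LinearMap.id - T)
  | k + 1 => if Even k then gen k ∘ₗ T else gen k ∘ₗ (LinearMap.id - T)

theorem gen_mul_deltaGen (T : W →ₗ[ℝ] W) (p : Module.Dual ℝ W) (k l : ℕ) (v w : W) :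
    gen k v * deltaGen T p l w = (-1 : ℝ) ^ ((k + 1) * l) • (deltaGen T p l w * gen k v) := by
  cases l with
  | zero =>
    simp only [deltaGen, LinearMap.comp_apply, Algebra.linearMap_apply, mul_zero, pow_zero,
      one_smul]
    exact (Algebra.commutes _ _).symm
  | succ l =>
    by_cases h : Even l
    · simp [deltaGen, h, gen_comm k l]
    · simp only [deltaGen, h, if_false, LinearMap.comp_apply]
      exact gen_comm k l v _

/-- The algebra homomorphism `x ↦ [[parity x, δ x], [0, x]]`. Its multiplicativity is the graded
Leibniz rule for `δ`. -/
def deltaMatrix (T : W →ₗ[ℝ] W) (p : Module.Dual ℝ W) :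
    Antighost W →ₐ[ℝ] Matrix (Fin 2) (Fin 2) (Antighost W) :=
  lift (fun k =>
    { toFun := fun w => !![parity (gen k w), deltaGen T p k w; 0, gen k w]
      map_add' := by intro v w; ext i j; fin_cases i <;> fin_cases j <;> simp
      map_smul' := by intro r w; ext i j; fin_cases i <;> fin_cases j <;> simp })
    (by
      intro k l v w
      ext i j
      fin_cases i <;> fin_cases j <;>
        simp only [LinearMap.coe_mk, AddHom.coe_mk, Matrix.mul_fin_two, parity_gen,
          Matrix.smul_apply, Fin.zero_eta, Fin.mk_one, Fin.isValue, Matrix.of_apply,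
          Matrix.cons_val', Matrix.cons_val_zero, Matrix.cons_val_one, Matrix.cons_val_fin_one,
          mul_zero, zero_mul, add_zero, zero_add, smul_zero]
      · rw [smul_mul_smul_comm, smul_mul_smul_comm, gen_comm k l v w, smul_smul, smul_smul]
        congr 1
        ring
      · have h1 := gen_mul_deltaGen T p k l v w
        have h2 := gen_mul_deltaGen T p l k w v
        rw [smul_mul_assoc, smul_mul_assoc, h1, h2, smul_add, smul_smul, smul_smul, smul_smul,
          add_comm]
        congr 1
        · rw [show (-1 : ℝ) ^ ((k + 1) * (l + 1)) * (-1) ^ (l + 1) * (-1) ^ ((l + 1) * k) =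
            ((-1) ^ ((k + 1) * (l + 1))) ^ 2 by ring, ← pow_mul, mul_comm, pow_mul]
          simp
        · congr 1
          ring
      · exact gen_comm k l v w)

/-- The graded derivation with the values `deltaGen T p` on generators. -/
def delta (T : W →ₗ[ℝ] W) (p : Module.Dual ℝ W) : Antighost W →ₗ[ℝ] Antighost W :=
  (LinearMap.proj 1 ∘ₗ LinearMap.proj 0 : Matrix (Fin 2) (Fin 2) (Antighost W) →ₗ[ℝ] Antighost W)
    ∘ₗ (deltaMatrix T p).toLinearMap

theorem delta_apply (T : W →ₗ[ℝ] W) (p : Module.Dual ℝ W) (x : Antighost W) :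
    delta T p x = deltaMatrix T p x 0 1 := rfl

theorem delta_gen (T : W →ₗ[ℝ] W) (p : Module.Dual ℝ W) (k : ℕ) (w : W) :
    delta T p (gen k w) = deltaGen T p k w := by
  simp [delta_apply, deltaMatrix, lift_gen]

theorem deltaMatrix_row (T : W →ₗ[ℝ] W) (p : Module.Dual ℝ W) (x : Antighost W) :
    deltaMatrix T p x 1 0 = 0 ∧ deltaMatrix T p x 0 0 = parity x ∧
      deltaMatrix T p x 1 1 = x := by
  have key : ∀ t : TensorAlgebra ℝ (DirectSum ℕ fun _ => W), ∀ x : Antighost W,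
      mk t = x →
      deltaMatrix T p x 1 0 = 0 ∧ deltaMatrix T p x 0 0 = parity x ∧
      deltaMatrix T p x 1 1 = x := by
    intro t
    induction t using TensorAlgebra.induction with
    | algebraMap r =>
      rintro _ rfl
      simp [AlgHom.commutes, Matrix.algebraMap_matrix_apply]
    | ι y =>
      rintro _ rfl
      induction y using DirectSum.induction_on with
      | zero => simp
      | of k w =>
        have : mk
            (TensorAlgebra.ι ℝ (DirectSum.of (fun _ => W) k w)) = gen k w := rfl
        rw [this]
        simp [deltaMatrix, lift_gen]
      | add y z hy hz => simp [hy, hz]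
    | mul s t hs ht =>
      rintro _ rfl
      have hs := hs _ rfl
      have ht := ht _ rfl
      simp [Matrix.mul_apply, Fin.sum_univ_two, hs, ht]
    | add s t hs ht =>
      rintro _ rfl
      have hs := hs _ rfl
      have ht := ht _ rfl
      simp [hs, ht]
  obtain ⟨t, ht⟩ := mk_surjective x
  exact key t x ht

theorem delta_mul (T : W →ₗ[ℝ] W) (p : Module.Dual ℝ W) (x y : Antighost W) :
    delta T p (x * y) = delta T p x * y + parity x * delta T p y := by
  have hx := deltaMatrix_row T p x
  have hy := deltaMatrix_row T p y
  simp [delta_apply, Matrix.mul_apply, Fin.sum_univ_two, hx, hy, add_comm]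

theorem delta_algebraMap (T : W →ₗ[ℝ] W) (p : Module.Dual ℝ W) (r : ℝ) :
    delta T p (algebraMap ℝ (Antighost W) r) = 0 := by
  simp [delta_apply, AlgHom.commutes, Matrix.algebraMap_matrix_apply]

end Fibre

/-! ## The configuration bundle, its jets, and the Legendre bundle -/

section Geometry

variable {m : ℕ}

/-- The model space of the configuration space: `(t, q^1, …, q^m)`. -/
abbrev Model (m : ℕ) : Type := ℝ × (Fin m → ℝ)

variable {Q : Type*} [TopologicalSpace Q] [ChartedSpace (Model m) Q]

/-- `τ : Q → ℝ` is a smooth fibre bundle with typical fibre `M`: it is locally trivial by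
diffeomorphisms over open subsets of the time axis. -/
def IsSmoothFibreBundle (m : ℕ) {Q : Type*} [TopologicalSpace Q] [ChartedSpace (Model m) Q]
    (M : Type*) [TopologicalSpace M] [ChartedSpace (Fin m → ℝ) M]
    (τ : Q → ℝ) : Prop :=
  ∀ t : ℝ, ∃ U : Set ℝ, IsOpen U ∧ t ∈ U ∧ ∃ e : OpenPartialHomeomorph Q (ℝ × M),
    e.source = τ ⁻¹' U ∧ e.target = U ×ˢ univ ∧ (∀ q ∈ e.source, (e q).1 = τ q) ∧
    ContMDiffOn 𝓘(ℝ, Model m) (𝓘(ℝ, ℝ).prod 𝓘(ℝ, Fin m → ℝ)) ∞ e e.source ∧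
    ContMDiffOn (𝓘(ℝ, ℝ).prod 𝓘(ℝ, Fin m → ℝ)) 𝓘(ℝ, Model m) ∞ e.symm e.target

/-- The bundle coordinates `(t, q^i)`: a smooth chart whose first coordinate is the time `τ`. -/
def IsBundleChart (τ : Q → ℝ) (φ : OpenPartialHomeomorph Q (Model m)) : Prop :=
  φ ∈ IsManifold.maximalAtlas 𝓘(ℝ, Model m) ∞ Q ∧ ∀ q ∈ φ.source, (φ q).1 = τ q

/-- The vertical tangent space at `q`. -/
def V (m : ℕ) {Q : Type*} [TopologicalSpace Q] [ChartedSpace (Model m) Q] (τ : Q → ℝ) (q : Q) : Submodule ℝ (TangentSpace 𝓘(ℝ, Model m) q) :=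
  LinearMap.ker (mfderiv 𝓘(ℝ, Model m) 𝓘(ℝ, ℝ) τ q).toLinearMap

/-- The fibre over `q` of the first jet bundle, as the set of tangent vectors `v` at `q` with
`dt(v) = 1`. -/
def J1 (m : ℕ) {Q : Type*} [TopologicalSpace Q] [ChartedSpace (Model m) Q] (τ : Q → ℝ) (q : Q) : Type :=
  {v : TangentSpace 𝓘(ℝ, Model m) q // (mfderiv 𝓘(ℝ, Model m) 𝓘(ℝ, ℝ) τ q v : ℝ) = 1}

/-- Vertical vectors act on jets by translation. -/
def J1.add {τ : Q → ℝ} {q : Q} (v : J1 m τ q) (w : V m τ q) : J1 m τ q :=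
  ⟨v.1 + w.1, by
    have h : mfderiv 𝓘(ℝ, Model m) 𝓘(ℝ, ℝ) τ q w.1 = 0 := w.2
    rw [map_add, h, add_zero]
    exact v.2⟩

/-- The Legendre bundle `V^*Q`, i.e. the vertical cotangent bundle. -/
structure VStar (m : ℕ) {Q : Type*} [TopologicalSpace Q] [ChartedSpace (Model m) Q] (τ : Q → ℝ) where
  /-- the base point -/
  q : Q
  /-- the momentum -/
  p : Module.Dual ℝ (V m τ q)

open Classical in
/-- The coordinate vector field `∂_i = ∂/∂q^i` of a bundle chart, as a vertical vector. (For a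
bundle chart and `q` in its domain, the `if` is satisfied, see `mfderiv_coordVec`.) -/
def coordVec (τ : Q → ℝ) (φ : OpenPartialHomeomorph Q (Model m)) (i : Fin m) (q : Q) : V m τ q :=
  if h : (mfderiv 𝓘(ℝ, Model m) 𝓘(ℝ, Model m) φ q).inverse
      ((0, Pi.single i 1) : Model m) ∈ V m τ q then ⟨_, h⟩ else 0

/-- In a bundle chart, `∂_i` is characterized by its coordinates. -/
theorem mfderiv_coordVec [IsManifold 𝓘(ℝ, Model m) ∞ Q] {τ : Q → ℝ}
    {φ : OpenPartialHomeomorph Q (Model m)} (hφ : IsBundleChart τ φ) {q : Q} (hq : q ∈ φ.source)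
    (i : Fin m) :
    mfderiv 𝓘(ℝ, Model m) 𝓘(ℝ, Model m) φ q (coordVec τ φ i q).1 =
      ((0, Pi.single i 1) : Model m) := by
  have hd : φ.MDifferentiable 𝓘(ℝ, Model m) 𝓘(ℝ, Model m) :=
    ⟨(contMDiffOn_of_mem_maximalAtlas hφ.1).mdifferentiableOn (by simp),
      (contMDiffOn_symm_of_mem_maximalAtlas hφ.1).mdifferentiableOn (by simp)⟩
  have hinv : (mfderiv 𝓘(ℝ, Model m) 𝓘(ℝ, Model m) φ q).IsInvertible := ⟨hd.mfderiv hq, rfl⟩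
  have hcomp : mfderiv 𝓘(ℝ, Model m) 𝓘(ℝ, ℝ) τ q =
      (ContinuousLinearMap.fst ℝ ℝ (Fin m → ℝ)).comp
        (mfderiv 𝓘(ℝ, Model m) 𝓘(ℝ, Model m) φ q) := by
    have h1 : HasMFDerivAt 𝓘(ℝ, Model m) 𝓘(ℝ, ℝ) (Prod.fst : Model m → ℝ) (φ q)
        (ContinuousLinearMap.fst ℝ ℝ (Fin m → ℝ)) :=
      (ContinuousLinearMap.fst ℝ ℝ (Fin m → ℝ)).hasMFDerivAt
    have h2 := h1.comp q (hd.mdifferentiableAt hq).hasMFDerivAt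
    refine (h2.congr_of_eventuallyEq ?_).mfderiv
    filter_upwards [φ.open_source.mem_nhds hq] with x hx
    exact (hφ.2 x hx).symm
  have hmem : (mfderiv 𝓘(ℝ, Model m) 𝓘(ℝ, Model m) φ q).inverse
      ((0, Pi.single i 1) : Model m) ∈ V m τ q := by
    change mfderiv 𝓘(ℝ, Model m) 𝓘(ℝ, ℝ) τ q _ = 0
    rw [hcomp]
    change (ContinuousLinearMap.fst ℝ ℝ (Fin m → ℝ)) (mfderiv 𝓘(ℝ, Model m) 𝓘(ℝ, Model m) φ q _) = 0
    erw [hinv.self_apply_inverse]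
    rfl
  rw [coordVec, dif_pos hmem]
  exact hinv.self_apply_inverse _

/-- The coordinates `v^i` of a tangent vector: `q^i_t` on jets, `\dot q^i` on vertical vectors. -/
def vel (φ : OpenPartialHomeomorph Q (Model m)) (i : Fin m) {q : Q}
    (v : TangentSpace 𝓘(ℝ, Model m) q) : ℝ :=
  (mfderiv 𝓘(ℝ, Model m) 𝓘(ℝ, Model m) φ q v : Model m).2 i

/-- The vertical coordinate covector `\overline{d}q^i`. -/
def coordCovec (τ : Q → ℝ) (φ : OpenPartialHomeomorph Q (Model m)) (i : Fin m) (q : Q) :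
    Module.Dual ℝ (V m τ q) where
  toFun v := vel φ i v.1
  map_add' := by
    intro v w
    simp only [vel, Submodule.coe_add, map_add]
    rfl
  map_smul' := by
    intro r v
    simp only [vel, Submodule.coe_smul, map_smul]
    rfl

/-- The holonomic coordinates `((t, q^i), p_i)` on `V^*Q`. -/
def coords {τ : Q → ℝ} (φ : OpenPartialHomeomorph Q (Model m)) (z : VStar m τ) :
    Model m × (Fin m → ℝ) :=
  (φ z.q, fun i => z.p (coordVec τ φ i z.q))

/-- `f` is a smooth function of the holonomic coordinates over the domain of `φ`. -/
def SmoothOver {τ : Q → ℝ} (φ : OpenPartialHomeomorph Q (Model m)) (f : VStar m τ → ℝ) : Prop :=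
  ∃ G : Model m × (Fin m → ℝ) → ℝ, ContDiffOn ℝ ∞ G (φ.target ×ˢ univ) ∧
    ∀ z : VStar m τ, z.q ∈ φ.source → f z = G (coords φ z)

/-- The algebra `C^∞(V^*Q)`. -/
def Cinf (m : ℕ) {Q : Type*} [TopologicalSpace Q] [ChartedSpace (Model m) Q] (τ : Q → ℝ) : Subalgebra ℝ (VStar m τ → ℝ) where
  carrier := {f | ∀ φ, IsBundleChart τ φ → SmoothOver φ f}
  mul_mem' := by
    intro f g hf hg φ hφ
    obtain ⟨F, hF, hF'⟩ := hf φ hφ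
    obtain ⟨G, hG, hG'⟩ := hg φ hφ
    exact ⟨_, hF.mul hG, fun z hz => by simp [hF' z hz, hG' z hz]⟩
  add_mem' := by
    intro f g hf hg φ hφ
    obtain ⟨F, hF, hF'⟩ := hf φ hφ
    obtain ⟨G, hG, hG'⟩ := hg φ hφ
    exact ⟨_, hF.add hG, fun z hz => by simp [hF' z hz, hG' z hz]⟩
  algebraMap_mem' := fun r φ _ => ⟨fun _ => r, contDiffOn_const, fun _ _ => rfl⟩

/-- The algebra of smooth functions on a submanifold `N` of `V^*Q`: those which near each point of
`N` are restrictions of smooth functions of the ambient coordinates. -/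
def CinfOn {τ : Q → ℝ} (N : Set (VStar m τ)) : Subalgebra ℝ (N → ℝ) where
  carrier := {f | ∀ z : N, ∀ φ, IsBundleChart τ φ → z.1.q ∈ φ.source →
    ∃ O : Set (Model m × (Fin m → ℝ)), IsOpen O ∧ coords φ z.1 ∈ O ∧
      ∃ G : Model m × (Fin m → ℝ) → ℝ, ContDiffOn ℝ ∞ G O ∧
        ∀ w : N, w.1.q ∈ φ.source → coords φ w.1 ∈ O → f w = G (coords φ w.1)}
  mul_mem' := by
    intro f g hf hg z φ hφ hz
    obtain ⟨O, hO, hzO, F, hF, hF'⟩ := hf z φ hφ hz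
    obtain ⟨O', hO', hzO', G, hG, hG'⟩ := hg z φ hφ hz
    refine ⟨O ∩ O', hO.inter hO', ⟨hzO, hzO'⟩, _,
      (hF.mono inter_subset_left).mul (hG.mono inter_subset_right), fun w hw hwO => ?_⟩
    simp [hF' w hw hwO.1, hG' w hw hwO.2]
  add_mem' := by
    intro f g hf hg z φ hφ hz
    obtain ⟨O, hO, hzO, F, hF, hF'⟩ := hf z φ hφ hz
    obtain ⟨O', hO', hzO', G, hG, hG'⟩ := hg z φ hφ hz
    refine ⟨O ∩ O', hO.inter hO', ⟨hzO, hzO'⟩, _,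
      (hF.mono inter_subset_left).add (hG.mono inter_subset_right), fun w hw hwO => ?_⟩
    simp [hF' w hw hwO.1, hG' w hw hwO.2]
  algebraMap_mem' := fun r _ _ _ _ =>
    ⟨univ, isOpen_univ, mem_univ _, fun _ => r, contDiffOn_const, fun _ _ _ => rfl⟩

/-- The ideal `I_N` of smooth functions on `V^*Q` which vanish on `N`. -/
def vanishingIdeal {τ : Q → ℝ} (N : Set (VStar m τ)) : Ideal (Cinf m τ) where
  carrier := {f | ∀ z ∈ N, f.1 z = 0}
  add_mem' := by
    intro f g hf hg z hz
    simp [hf z hz, hg z hz]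
  zero_mem' := fun _ _ => rfl
  smul_mem' := by
    intro r f hf z hz
    simp [hf z hz]

/-- `f` is a smooth function on the domain of the chart `φ` of `Q`. -/
def SmoothOnChart (φ : OpenPartialHomeomorph Q (Model m)) (f : Q → ℝ) : Prop :=
  ContMDiffOn 𝓘(ℝ, Model m) 𝓘(ℝ, ℝ) ∞ f φ.source

/-- The components `a_{ij}` of a fibre bilinear form in `VQ`. -/
def aCoord {τ : Q → ℝ} (a : ∀ q, V m τ q →ₗ[ℝ] Module.Dual ℝ (V m τ q))
    (φ : OpenPartialHomeomorph Q (Model m)) (i j : Fin m) (q : Q) : ℝ :=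
  a q (coordVec τ φ i q) (coordVec τ φ j q)

/-- The components `σ^{jk}` of a linear bundle map `V^*Q → VQ`, so that
`\dot q^j ∘ σ = σ^{jk} p_k`. -/
def sigmaCoord {τ : Q → ℝ} (σ : ∀ q, Module.Dual ℝ (V m τ q) →ₗ[ℝ] V m τ q)
    (φ : OpenPartialHomeomorph Q (Model m)) (j k : Fin m) (q : Q) : ℝ :=
  coordCovec τ φ j q (σ q (coordCovec τ φ k q))

/-- `ℒ` is a smooth quadratic Lagrangian function on `J^1Q` with the (symmetric) fibre metric `a`:
`ℒ = ½ a_{ij} q^i_t q^j_t + b_i q^i_t + c` with smooth local functions `a_{ij}`, `b_i`, `c` on `Q`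
in all bundle coordinates. -/
def IsQuadraticLagrangian (τ : Q → ℝ) (ℒ : ∀ q, J1 m τ q → ℝ)
    (a : ∀ q, V m τ q →ₗ[ℝ] Module.Dual ℝ (V m τ q)) : Prop :=
  (∀ q v w, a q v w = a q w v) ∧
  ∀ φ, IsBundleChart τ φ →
    (∀ i j, SmoothOnChart φ (aCoord a φ i j)) ∧
    ∃ (b : Fin m → Q → ℝ) (c : Q → ℝ), (∀ i, SmoothOnChart φ (b i)) ∧ SmoothOnChart φ c ∧
      ∀ q ∈ φ.source, ∀ v : J1 m τ q,
        ℒ q v = (1 / 2) * ∑ i, ∑ j, aCoord a φ i j q * vel φ i v.1 * vel φ j v.1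
          + ∑ i, b i q * vel φ i v.1 + c q

/-- The Lagrangian constraint space `N_L ⊆ V^*Q`: the image of the Legendre map, which sends a jet
`v` to the fibre derivative of `ℒ` at `v`. -/
def constraintSpace {τ : Q → ℝ} (ℒ : ∀ q, J1 m τ q → ℝ) : Set (VStar m τ) :=
  {z | ∃ v : J1 m τ z.q, ∀ w : V m τ z.q,
    HasDerivAt (fun s : ℝ => ℒ z.q (v.add (s • w))) (z.p w) 0}

/-- `σ` is a smooth symmetric linear bundle map `V^*Q → VQ` with `a σ a = a` and `σ a σ = σ`. -/
def IsSigmaZero {τ : Q → ℝ} (a : ∀ q, V m τ q →ₗ[ℝ] Module.Dual ℝ (V m τ q))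
    (σ : ∀ q, Module.Dual ℝ (V m τ q) →ₗ[ℝ] V m τ q) : Prop :=
  (∀ q (p p' : Module.Dual ℝ (V m τ q)), p (σ q p') = p' (σ q p)) ∧
  (∀ φ, IsBundleChart τ φ → ∀ j k, SmoothOnChart φ (sigmaCoord σ φ j k)) ∧
  (∀ q v, a q (σ q (a q v)) = a q v) ∧ (∀ q p, σ q (a q (σ q p)) = σ q p)

/-! ## BRST functions and the Koszul–Tate complex -/

/-- (Arbitrary) sections over `V^*Q` of the bundle of antighost superalgebras. The fibre of the
bundle of antighosts of a fixed antighost number is the dual of the vertical tangent space of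
`V^*Q → Q`, which is the vertical tangent space `V_qQ`; under this identification the
holonomic basis element `c_i^{(k)}` corresponds to `∂_i` (both are transformed like `p_i`). -/
abbrev Sections (m : ℕ) {Q : Type*} [TopologicalSpace Q] [ChartedSpace (Model m) Q] (τ : Q → ℝ) : Type _ := ∀ z : VStar m τ, Antighost (V m τ z.q)

/-- The local BRST function `c_i^{(k+1)}` over the domain of a bundle chart. -/
def cLoc (τ : Q → ℝ) (φ : OpenPartialHomeomorph Q (Model m)) (k : ℕ) (i : Fin m) : Sections m τ :=
  fun z => gen k (coordVec τ φ i z.q)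

/-- The antighost number of a word in the local generators `c_i^{(k+1)}`. -/
def antighostNumber (w : List (ℕ × Fin m)) : ℕ := (w.map fun x => x.1 + 1).sum

/-- The product of the local generators in a word. -/
def monomial (τ : Q → ℝ) (φ : OpenPartialHomeomorph Q (Model m)) (w : List (ℕ × Fin m)) :
    Sections m τ :=
  (w.map fun x => cLoc τ φ x.1 x.2).prod

/-- `f` is over the domain of `φ` a finite sum of monomials of antighost number `k` in the local
generators, with smooth functions on `V^*Q` as coefficients. -/
def BRSTOver {τ : Q → ℝ} (φ : OpenPartialHomeomorph Q (Model m)) (k : ℕ) (f : Sections m τ) : Prop :=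
  ∃ (s : Finset (List (ℕ × Fin m))) (g : List (ℕ × Fin m) → VStar m τ → ℝ),
    (∀ w ∈ s, antighostNumber w = k ∧ SmoothOver φ (g w)) ∧
    ∀ z : VStar m τ, z.q ∈ φ.source → f z = ∑ w ∈ s, g w z • monomial τ φ w z

theorem BRSTOver.zero {τ : Q → ℝ} (φ : OpenPartialHomeomorph Q (Model m)) (k : ℕ) :
    BRSTOver φ k (0 : Sections m τ) :=
  ⟨∅, fun _ _ => 0, by simp, by simp⟩

theorem BRSTOver.smul {τ : Q → ℝ} {φ : OpenPartialHomeomorph Q (Model m)} {k : ℕ}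
    {f : Sections m τ} (h : BRSTOver φ k f) (r : ℝ) : BRSTOver φ k (r • f) := by
  obtain ⟨s, g, hg, hf⟩ := h
  refine ⟨s, fun w z => r * g w z, fun w hw => ⟨(hg w hw).1, ?_⟩, fun z hz => ?_⟩
  · obtain ⟨G, hG, hG'⟩ := (hg w hw).2
    exact ⟨fun x => r * G x, contDiffOn_const.mul hG, fun z hz => by simp [hG' z hz]⟩
  · simp [hf z hz, Finset.smul_sum, mul_smul]

theorem BRSTOver.add {τ : Q → ℝ} {φ : OpenPartialHomeomorph Q (Model m)} {k : ℕ}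
    {f f' : Sections m τ} (h : BRSTOver φ k f) (h' : BRSTOver φ k f') : BRSTOver φ k (f + f') := by
  classical
  obtain ⟨s, g, hg, hf⟩ := h
  obtain ⟨s', g', hg', hf'⟩ := h'
  refine ⟨s ∪ s', fun w z => (if w ∈ s then g w z else 0) + (if w ∈ s' then g' w z else 0),
    fun w hw => ⟨?_, ?_⟩, fun z hz => ?_⟩
  · rcases Finset.mem_union.1 hw with h | h
    exacts [(hg w h).1, (hg' w h).1]
  · have h1 : SmoothOver φ (fun z => if w ∈ s then g w z else 0) := by
      by_cases h : w ∈ s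
      · simpa [h] using (hg w h).2
      · exact ⟨fun _ => 0, contDiffOn_const, fun _ _ => by simp [h]⟩
    have h2 : SmoothOver φ (fun z => if w ∈ s' then g' w z else 0) := by
      by_cases h : w ∈ s'
      · simpa [h] using (hg' w h).2
      · exact ⟨fun _ => 0, contDiffOn_const, fun _ _ => by simp [h]⟩
    obtain ⟨F, hF, hF'⟩ := h1
    obtain ⟨G, hG, hG'⟩ := h2
    exact ⟨_, hF.add hG, fun z hz => by simp only [hF' z hz, hG' z hz]⟩
  · rw [Pi.add_apply, hf z hz, hf' z hz]
    simp only [add_smul, Finset.sum_add_distrib, ite_smul, zero_smul, Finset.sum_ite_mem,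
      Finset.union_inter_cancel_left, Finset.union_inter_cancel_right]

/-- The module `𝒩^k` of BRST functions of antighost number `k`. -/
def BRST (m : ℕ) {Q : Type*} [TopologicalSpace Q] [ChartedSpace (Model m) Q] (τ : Q → ℝ) (k : ℕ) : Submodule ℝ (Sections m τ) where
  carrier := {f | ∀ φ, IsBundleChart τ φ → BRSTOver φ k f}
  add_mem' := fun hf hg φ hφ => (hf φ hφ).add (hg φ hφ)
  zero_mem' := fun φ _ => BRSTOver.zero φ k
  smul_mem' := fun r _ hf φ hφ => (hf φ hφ).smul r

/-- Functions on `V^*Q` as sections. -/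
def ofFun (m : ℕ) {Q : Type*} [TopologicalSpace Q] [ChartedSpace (Model m) Q] (τ : Q → ℝ) : (VStar m τ → ℝ) →ₗ[ℝ] Sections m τ :=
  LinearMap.pi fun z => Algebra.linearMap ℝ (Antighost (V m τ z.q)) ∘ₗ LinearMap.proj z

/-- The Koszul–Tate differential. At the point `z = (q, p)` it is the graded derivation with
`c^{(1)}(v) ↦ p (v - σ a v)`, `c^{(2r)}(v) ↦ c^{(2r-1)}(σ a v)`,
`c^{(2r+1)}(v) ↦ c^{(2r)}(v - σ a v)`. -/
def ktDelta {τ : Q → ℝ} (a : ∀ q, V m τ q →ₗ[ℝ] Module.Dual ℝ (V m τ q))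
    (σ : ∀ q, Module.Dual ℝ (V m τ q) →ₗ[ℝ] V m τ q) : Sections m τ →ₗ[ℝ] Sections m τ :=
  LinearMap.pi fun z => delta (σ z.q ∘ₗ a z.q) z.p ∘ₗ LinearMap.proj z

/-- The cycles of antighost number `k`. -/
def cycles {τ : Q → ℝ} (d : Sections m τ →ₗ[ℝ] Sections m τ) (k : ℕ) : Submodule ℝ (Sections m τ) :=
  BRST m τ k ⊓ LinearMap.ker d

/-- The boundaries of antighost number `k`. -/
def boundaries {τ : Q → ℝ} (d : Sections m τ →ₗ[ℝ] Sections m τ) (k : ℕ) :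
    Submodule ℝ (Sections m τ) :=
  (BRST m τ (k + 1)).map d

/-- The homology `H_k` of the complex of BRST functions with respect to `d`. -/
abbrev Homology {τ : Q → ℝ} (d : Sections m τ →ₗ[ℝ] Sections m τ) (k : ℕ) : Type _ :=
  cycles d k ⧸ (boundaries d k).submoduleOf (cycles d k)

end Geometry

end KoszulTate

end

noncomputable section

namespace KoszulTate

/-! ### The algebra of antighosts over one point of `Q`: induction, parity, scaling. -/

section Fibre

variable {W : Type*} [AddCommGroup W] [Module ℝ W]

/-! Fix `q` in `Q`. Since `a σ a = a`, the endomorphism `T = σ ∘ a` of the vertical tangent space is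
a projector, which splits that space into the range and the kernel of `T`, and a momentum `p` into
`p ∘ T` and its transverse part `p ∘ (1 - T)`. The differential pairs off generators: on the range
of `T` it sends `c⁽²⁾` to `c⁽¹⁾`, `c⁽⁴⁾` to `c⁽³⁾`, and so on; on the kernel it sends `c⁽³⁾` to
`c⁽²⁾`, `c⁽⁵⁾` to `c⁽⁴⁾`, and so on. Only `c⁽¹⁾` on the kernel is left, and it goes to the
transverse momenta. The fibre complex is thus made of contractible pairs and the Koszul complex of
some linear coordinates, and only functions of `p ∘ T` should survive.

The contraction is explicit, as in the Poincaré lemma. The odd derivation `homotopy` inverts the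
pairs, and the operator `∑ c⁽¹⁾(e_i - T e_i) ∂/∂p_i` inverts the Koszul part. The anticommutator of
their sum with `δ` counts antighosts and transverse momenta; `euler_word` is the algebraic half of
this. For smooth coefficients the count is inverted by scaling antighosts and transverse momenta by
`t` and integrating over `[0, 1]`. By the fundamental theorem of calculus, a cycle `F` satisfies `δ
h F = F - F₀`, where `F₀` is `F` at `p ∘ T` with the antighosts set to zero (`delta_fibreHomotopy`).

The homotopy is canonical: tested against linear functionals, its value depends on `F` only and not
on a chart (`dual_fibreHomotopy_eq_integral_kernel`). So `ktHomotopy` is globally defined without a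
partition of unity. In each chart its coefficients are integrals depending smoothly on parameters,
so it preserves BRST functions (`ktHomotopy_mem_BRST`). In positive antighost number `F₀ = 0`, and
the homology vanishes.

In degree zero, a jet `v₀` with zero momentum exists over each `q`, so the Legendre map is `v ↦ a (v
- v₀)` and `N_L` is the set where `p ∘ T = p` (`mem_constraintSpace_iff`). Hence `p ↦ p ∘ T` is a
smooth retraction onto `N_L`. A function `f` vanishing on `N_L` has `F₀ = 0` and is the boundary `δ
h f`; boundaries vanish on `N_L` (`counit_delta`); functions on `N_L` extend by pullback along the
retraction (`exists_cinf_extension`). -/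

theorem Antighost.induction {P : Antighost W → Prop} (one : P 1)
    (gen_mul : ∀ k w x, P x → P (gen k w * x)) (smul : ∀ (r : ℝ) x, P x → P (r • x))
    (add : ∀ x y, P x → P y → P (x + y)) (x : Antighost W) : P x := by
  -- Products in the tensor algebra need the claim for left multiplication of an arbitrary `y`
  -- satisfying `P`, not only for `y = 1`.
  have key : ∀ t : TensorAlgebra ℝ (DirectSum ℕ fun _ => W), ∀ y, P y → P (mk t * y) := by
    intro t
    induction t using TensorAlgebra.induction with
    | algebraMap r =>
      intro y hy
      rw [AlgHom.commutes, ← Algebra.smul_def]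
      exact smul r y hy
    | ι v =>
      intro y hy
      induction v using DirectSum.induction_on with
      | zero => simpa using smul 0 1 one
      | of k w => exact gen_mul k w y hy
      | add v w hv hw =>
        rw [map_add, map_add, add_mul]
        exact add _ _ hv hw
    | mul s t hs ht =>
      intro y hy
      rw [map_mul, mul_assoc]
      exact hs _ (ht _ hy)
    | add s t hs ht =>
      intro y hy
      rw [map_add, add_mul]
      exact add _ _ (hs _ hy) (ht _ hy)
  obtain ⟨t, rfl⟩ := mk_surjective x
  simpa using key t 1 one

theorem parity_gen_mul (k : ℕ) (w : W) (x : Antighost W) :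
    parity (gen k w * x) = (-1 : ℝ) ^ (k + 1) • (gen k w * parity x) := by
  rw [map_mul, parity_gen, smul_mul_assoc]

theorem parity_parity (x : Antighost W) : parity (parity x) = x := by
  induction x using Antighost.induction with
  | one => simp
  | gen_mul k w x hx =>
    rw [parity_gen_mul, map_smul, parity_gen_mul, hx, smul_smul, ← pow_add, Even.neg_one_pow
      (Even.add_self _), one_smul]
  | smul r x hx => rw [map_smul, map_smul, hx]
  | add x y hx hy => rw [map_add, map_add, hx, hy]

/-- Evaluation of an antighost polynomial at zero antighosts. -/
def counit : Antighost W →ₐ[ℝ] ℝ := lift (fun _ => 0) (by simp)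

theorem counit_gen (k : ℕ) (w : W) : counit (gen k w) = 0 := by simp [counit, lift_gen]

/-- Multiplication of all antighosts by `t`. -/
def scale (t : ℝ) : Antighost W →ₐ[ℝ] Antighost W :=
  lift (fun k => t • gen k) (by
    intro k l v w
    simp only [LinearMap.smul_apply, smul_mul_smul_comm, gen_comm k l v w, smul_smul]
    congr 1
    ring)

theorem scale_gen (t : ℝ) (k : ℕ) (w : W) : scale t (gen k w) = t • gen k w := by
  simp [scale, lift_gen]

/-! ### Odd derivations -/

/-- An odd derivation of the algebra of antighosts. -/
def IsOddDerivation (D : Antighost W →ₗ[ℝ] Antighost W) : Prop :=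
  ∀ x y, D (x * y) = D x * y + parity x * D y

namespace IsOddDerivation

variable {D D' : Antighost W →ₗ[ℝ] Antighost W}

theorem gen_mul (hD : IsOddDerivation D) (k : ℕ) (w : W) (x : Antighost W) :
    D (gen k w * x) = D (gen k w) * x + (-1 : ℝ) ^ (k + 1) • (gen k w * D x) := by
  rw [hD, parity_gen, smul_mul_assoc]

theorem map_one (hD : IsOddDerivation D) : D 1 = 0 := by
  have h := hD 1 1
  simpa using h

theorem add (hD : IsOddDerivation D) (hD' : IsOddDerivation D') : IsOddDerivation (D + D') := by
  intro x y
  simp only [LinearMap.add_apply, hD x y, hD' x y, add_mul, mul_add]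
  abel

theorem smul (hD : IsOddDerivation D) (r : ℝ) : IsOddDerivation (r • D) := by
  intro x y
  simp only [LinearMap.smul_apply, hD x y, smul_add, smul_mul_assoc, mul_smul_comm]

theorem sub (hD : IsOddDerivation D) (hD' : IsOddDerivation D') : IsOddDerivation (D - D') := by
  intro x y
  simp only [LinearMap.sub_apply, hD x y, hD' x y, sub_mul, mul_sub]
  abel

theorem ext (hD : IsOddDerivation D) (hD' : IsOddDerivation D')
    (h : ∀ k w, D (gen k w) = D' (gen k w)) : D = D' := by
  refine LinearMap.ext fun x => ?_
  induction x using Antighost.induction with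
  | one => rw [hD.map_one, hD'.map_one]
  | gen_mul k w x hx => rw [hD.gen_mul, hD'.gen_mul, h, hx]
  | smul r x hx => rw [map_smul, map_smul, hx]
  | add x y hx hy => rw [map_add, map_add, hx, hy]

/-- An odd derivation reverses parity if it does so on the generators. -/
theorem map_parity (hD : IsOddDerivation D)
    (h : ∀ k w, parity (D (gen k w)) = (-1 : ℝ) ^ k • D (gen k w)) (x : Antighost W) :
    D (parity x) = -parity (D x) := by
  induction x using Antighost.induction with
  | one => simp [hD.map_one]
  | gen_mul k w x hx =>
    rw [parity_gen_mul, map_smul, hD.gen_mul, hD.gen_mul, map_add, map_smul, parity_gen_mul,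
      map_mul, h, hx]
    simp only [smul_add, smul_mul_assoc, mul_neg, smul_neg, neg_add, pow_succ]
    congr 1
    module
  | smul r x hx => rw [map_smul, map_smul, map_smul, map_smul, hx, smul_neg]
  | add x y hx hy =>
    rw [map_add, map_add, map_add, map_add, hx, hy, neg_add]

end IsOddDerivation

/-- The algebra homomorphism `x ↦ [[parity x, D x], [0, x]]` of an odd derivation `D`, given by
the values of `D` on generators. -/
def derivMatrix (D : ℕ → W →ₗ[ℝ] Antighost W)
    (hD : ∀ k l v w, gen k v * D l w = (-1 : ℝ) ^ ((k + 1) * l) • (D l w * gen k v)) :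
    Antighost W →ₐ[ℝ] Matrix (Fin 2) (Fin 2) (Antighost W) :=
  lift (fun k =>
    { toFun := fun w => !![parity (gen k w), D k w; 0, gen k w]
      map_add' := by intro v w; ext i j; fin_cases i <;> fin_cases j <;> simp
      map_smul' := by intro r w; ext i j; fin_cases i <;> fin_cases j <;> simp })
    (by
      intro k l v w
      ext i j
      fin_cases i <;> fin_cases j <;>
        simp only [LinearMap.coe_mk, AddHom.coe_mk, Matrix.mul_fin_two, parity_gen,
          Matrix.smul_apply, Fin.zero_eta, Fin.mk_one, Fin.isValue, Matrix.of_apply,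
          Matrix.cons_val', Matrix.cons_val_zero, Matrix.cons_val_one, Matrix.cons_val_fin_one,
          mul_zero, zero_mul, add_zero, zero_add, smul_zero]
      · rw [smul_mul_smul_comm, smul_mul_smul_comm, gen_comm k l v w, smul_smul, smul_smul]
        congr 1
        ring
      · have h1 := hD k l v w
        have h2 := hD l k w v
        rw [smul_mul_assoc, smul_mul_assoc, h1, h2, smul_add, smul_smul, smul_smul, smul_smul,
          add_comm]
        congr 1
        · rw [show (-1 : ℝ) ^ ((k + 1) * (l + 1)) * (-1) ^ (l + 1) * (-1) ^ ((l + 1) * k) =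
            ((-1) ^ ((k + 1) * (l + 1))) ^ 2 by ring, ← pow_mul, mul_comm, pow_mul]
          simp
        · congr 1
          ring
      · exact gen_comm k l v w)

/-- The odd derivation with prescribed values on the generators. -/
def oddDeriv (D : ℕ → W →ₗ[ℝ] Antighost W)
    (hD : ∀ k l v w, gen k v * D l w = (-1 : ℝ) ^ ((k + 1) * l) • (D l w * gen k v)) :
    Antighost W →ₗ[ℝ] Antighost W :=
  (LinearMap.proj 1 ∘ₗ LinearMap.proj 0 : Matrix (Fin 2) (Fin 2) (Antighost W) →ₗ[ℝ] Antighost W)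
    ∘ₗ (derivMatrix D hD).toLinearMap

section

variable (D : ℕ → W →ₗ[ℝ] Antighost W)
    (hD : ∀ k l v w, gen k v * D l w = (-1 : ℝ) ^ ((k + 1) * l) • (D l w * gen k v))

theorem oddDeriv_apply (x : Antighost W) : oddDeriv D hD x = derivMatrix D hD x 0 1 := rfl

theorem oddDeriv_gen (k : ℕ) (w : W) : oddDeriv D hD (gen k w) = D k w := by
  simp [oddDeriv_apply, derivMatrix, lift_gen]

theorem derivMatrix_row (x : Antighost W) :
    derivMatrix D hD x 1 0 = 0 ∧ derivMatrix D hD x 0 0 = parity x ∧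
      derivMatrix D hD x 1 1 = x := by
  induction x using Antighost.induction with
  | one => simp
  | gen_mul k w x hx =>
    have : derivMatrix D hD (gen k w) = !![parity (gen k w), D k w; 0, gen k w] := by
      simp [derivMatrix, lift_gen]
    simp [Matrix.mul_apply, Fin.sum_univ_two, this, hx]
  | smul r x hx => simp [hx]
  | add x y hx hy => simp [hx, hy]

theorem isOddDerivation_oddDeriv : IsOddDerivation (oddDeriv D hD) := by
  intro x y
  have hx := derivMatrix_row D hD x
  have hy := derivMatrix_row D hD y
  simp [oddDeriv_apply, Matrix.mul_apply, Fin.sum_univ_two, hx, hy, add_comm]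

end

/-! ### The differential at a point, its contractions and its contracting homotopy. -/

theorem isOddDerivation_delta (T : W →ₗ[ℝ] W) (p : Module.Dual ℝ W) :
    IsOddDerivation (delta T p) := delta_mul T p

theorem parity_deltaGen (T : W →ₗ[ℝ] W) (p : Module.Dual ℝ W) (k : ℕ) (w : W) :
    parity (deltaGen T p k w) = (-1 : ℝ) ^ k • deltaGen T p k w := by
  cases k with
  | zero => simp [deltaGen]
  | succ k =>
    simp only [deltaGen]
    split_ifs <;> simp [parity_gen, smul_sub]

theorem delta_parity (T : W →ₗ[ℝ] W) (p : Module.Dual ℝ W) (x : Antighost W) :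
    delta T p (parity x) = -parity (delta T p x) :=
  (isOddDerivation_delta T p).map_parity (fun k w => by rw [delta_gen, parity_deltaGen]) x

theorem delta_one (T : W →ₗ[ℝ] W) (p : Module.Dual ℝ W) : delta T p 1 = 0 :=
  (isOddDerivation_delta T p).map_one

/-- Two successive steps apply `T` and `1 - T` in some order, and their product is zero for a
projector; from `c⁽²⁾` the second step is `p ∘ (1 - T)`, from `c⁽¹⁾` the first already lands in
scalars. -/
theorem delta_deltaGen (T : W →ₗ[ℝ] W) (hT : ∀ w, T (T w) = T w) (p : Module.Dual ℝ W) (k : ℕ)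
    (w : W) : delta T p (deltaGen T p k w) = 0 := by
  match k with
  | 0 => simp [deltaGen, delta_algebraMap]
  | 1 => simp [deltaGen, delta_gen, hT]
  | k + 2 =>
    by_cases h : Even k <;>
      simp [deltaGen, delta_gen, hT, h, Nat.even_add_one]

/-- The cross terms in the square of an odd derivation cancel because `δ` anticommutes with
`parity`, so it is enough to know the square on generators. -/
theorem delta_delta (T : W →ₗ[ℝ] W) (hT : ∀ w, T (T w) = T w) (p : Module.Dual ℝ W)
    (x : Antighost W) : delta T p (delta T p x) = 0 := by
  induction x using Antighost.induction with
  | one => rw [delta_one, map_zero]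
  | gen_mul k w x hx =>
    rw [delta_mul, map_add, delta_mul, delta_mul, delta_parity, parity_parity, hx, delta_gen,
      delta_deltaGen T hT]
    simp
  | smul r x hx => rw [map_smul, map_smul, hx, smul_zero]
  | add x y hx hy => rw [map_add, map_add, hx, hy, add_zero]

/-- At a momentum which is fixed by the projection, `delta` maps into the antighosts. -/
theorem counit_delta (T : W →ₗ[ℝ] W) (p : Module.Dual ℝ W) (hp : ∀ w, p (T w) = p w)
    (x : Antighost W) : counit (delta T p x) = 0 := by
  induction x using Antighost.induction with
  | one => rw [delta_one, map_zero]
  | gen_mul k w x hx =>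
    rw [delta_mul, map_add, map_mul, map_mul, hx, mul_zero, add_zero, delta_gen]
    cases k with
    | zero => simp [deltaGen, hp]
    | succ k =>
      simp only [deltaGen]
      split_ifs <;> simp [counit_gen]
  | smul r x hx => rw [map_smul, map_smul, hx, smul_zero]
  | add x y hx hy => rw [map_add, map_add, hx, hy, add_zero]

/-- The contraction with a covector `α` along the complement of the range of the projection `T`. -/
def contr (T : W →ₗ[ℝ] W) (α : Module.Dual ℝ W) : Antighost W →ₗ[ℝ] Antighost W :=
  delta T α - delta T 0

theorem isOddDerivation_contr (T : W →ₗ[ℝ] W) (α : Module.Dual ℝ W) :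
    IsOddDerivation (contr T α) :=
  (isOddDerivation_delta T α).sub (isOddDerivation_delta T 0)

theorem contr_gen_zero (T : W →ₗ[ℝ] W) (α : Module.Dual ℝ W) (w : W) :
    contr T α (gen 0 w) = algebraMap ℝ _ (α (w - T w)) := by
  simp [contr, delta_gen, deltaGen]

theorem contr_gen_succ (T : W →ₗ[ℝ] W) (α : Module.Dual ℝ W) (k : ℕ) (w : W) :
    contr T α (gen (k + 1) w) = 0 := by
  simp [contr, delta_gen, deltaGen]

/-- The momentum enters only through the value on `c⁽¹⁾`, where it is linear. This makes `contr` the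
derivative of `delta` with respect to the momentum. -/
theorem delta_add_smul (T : W →ₗ[ℝ] W) (p α : Module.Dual ℝ W) (ε : ℝ) :
    delta T (p + ε • α) = delta T p + ε • contr T α := by
  refine (isOddDerivation_delta T _).ext
    ((isOddDerivation_delta T p).add ((isOddDerivation_contr T α).smul ε)) fun k w => ?_
  cases k with
  | zero =>
    rw [LinearMap.add_apply, LinearMap.smul_apply, contr_gen_zero, delta_gen, delta_gen]
    simp [deltaGen, Algebra.smul_def, mul_sub]
  | succ k =>
    rw [LinearMap.add_apply, LinearMap.smul_apply, contr_gen_succ, delta_gen, delta_gen]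
    simp [deltaGen]

/-- The values of the contracting homotopy on generators. -/
def homotopyGen (T : W →ₗ[ℝ] W) (k : ℕ) : W →ₗ[ℝ] Antighost W :=
  if Even k then gen (k + 1) ∘ₗ T else gen (k + 1) ∘ₗ (LinearMap.id - T)

/-- Raising the degree by one instead of lowering it changes the sign exponent by the even number `2
* (k + 1)`, so this odd map meets the same compatibility condition as the differential. -/
theorem gen_mul_homotopyGen (T : W →ₗ[ℝ] W) (k l : ℕ) (v w : W) :
    gen k v * homotopyGen T l w = (-1 : ℝ) ^ ((k + 1) * l) • (homotopyGen T l w * gen k v) := by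
  have h : (-1 : ℝ) ^ ((k + 1) * (l + 1 + 1)) = (-1 : ℝ) ^ ((k + 1) * l) := by
    rw [show (k + 1) * (l + 1 + 1) = (k + 1) * l + 2 * (k + 1) by ring, pow_add, pow_mul (-1) 2]
    simp
  unfold homotopyGen
  split_ifs <;>
    simp only [LinearMap.comp_apply] <;> rw [gen_comm, h]

/-- The part of the contracting homotopy which does not differentiate coefficients: the odd
derivation with the values `homotopyGen T` on generators. -/
def homotopy (T : W →ₗ[ℝ] W) : Antighost W →ₗ[ℝ] Antighost W :=
  oddDeriv (homotopyGen T) (gen_mul_homotopyGen T)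

theorem isOddDerivation_homotopy (T : W →ₗ[ℝ] W) : IsOddDerivation (homotopy T) :=
  isOddDerivation_oddDeriv _ _

theorem homotopy_gen (T : W →ₗ[ℝ] W) (k : ℕ) (w : W) :
    homotopy T (gen k w) = homotopyGen T k w := oddDeriv_gen _ _ _ _

theorem homotopy_parity (T : W →ₗ[ℝ] W) (x : Antighost W) :
    homotopy T (parity x) = -parity (homotopy T x) := by
  refine (isOddDerivation_homotopy T).map_parity (fun k w => ?_) x
  rw [homotopy_gen, homotopyGen]
  split_ifs <;> simp [parity_gen, pow_succ, smul_sub]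

/-- On generators `δ` is linear in the antighosts and the transverse momenta taken together, so
scaling both by `t` commutes with it. -/
theorem scale_delta (T : W →ₗ[ℝ] W) (p : Module.Dual ℝ W) (t : ℝ) (p' : Module.Dual ℝ W)
    (hp : ∀ w, p' (w - T w) = t * p (w - T w)) (x : Antighost W) :
    scale t (delta T p' x) = delta T p (scale t x) := by
  induction x using Antighost.induction with
  | one => rw [delta_one, map_zero, map_one, delta_one]
  | gen_mul k w x hx =>
    rw [(isOddDerivation_delta T p').gen_mul, map_mul, map_add, map_mul, map_smul, map_mul, hx,
      scale_gen, smul_mul_assoc, smul_mul_assoc, map_smul, (isOddDerivation_delta T p).gen_mul,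
      smul_add]
    congr 1
    · rw [← smul_mul_assoc, delta_gen, delta_gen]
      congr 1
      cases k with
      | zero =>
        have := hp w
        simp only [deltaGen, LinearMap.comp_apply, LinearMap.sub_apply, LinearMap.id_apply,
          Algebra.linearMap_apply, AlgHom.commutes, this, Algebra.smul_def, ← map_mul]
      | succ k =>
        simp only [deltaGen]
        split_ifs <;> simp [scale_gen, smul_sub]
    · rw [smul_comm]
  | smul r x hx => rw [map_smul, map_smul, map_smul, map_smul, hx]
  | add x y hx hy => rw [map_add, map_add, map_add, map_add, hx, hy]

/-- A contraction removes exactly one antighost; the factor `t` on the left restores the missing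
weight. -/
theorem scale_contr (T : W →ₗ[ℝ] W) (α : Module.Dual ℝ W) (t : ℝ) (x : Antighost W) :
    t • scale t (contr T α x) = contr T α (scale t x) := by
  induction x using Antighost.induction with
  | one => simp [(isOddDerivation_contr T α).map_one]
  | gen_mul k w x hx =>
    rw [(isOddDerivation_contr T α).gen_mul, map_mul, map_add, map_mul, map_smul, map_mul,
      scale_gen, smul_mul_assoc, smul_mul_assoc, map_smul, (isOddDerivation_contr T α).gen_mul, ← hx]
    simp only [smul_add, mul_smul_comm]
    congr 1
    cases k with
    | zero => simp [contr_gen_zero]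
    | succ k => simp [contr_gen_succ]
  | smul r x hx => rw [map_smul, map_smul, map_smul, map_smul, ← hx, smul_comm]
  | add x y hx hy => rw [map_add, map_add, map_add, map_add, smul_add, hx, hy]

/-! ### Words -/

/-- The product of the generators in a word. -/
def word (l : List (ℕ × W)) : Antighost W := (l.map fun x => gen x.1 x.2).prod

@[simp]
theorem word_nil : word ([] : List (ℕ × W)) = 1 := rfl

@[simp]
theorem word_cons (x : ℕ × W) (l : List (ℕ × W)) : word (x :: l) = gen x.1 x.2 * word l := by
  simp [word]

theorem scale_word (t : ℝ) (l : List (ℕ × W)) : scale t (word l) = t ^ l.length • word l := by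
  induction l with
  | nil => simp
  | cons x l ih =>
    rw [word_cons, map_mul, ih, scale_gen, smul_mul_smul_comm, List.length_cons, pow_succ']

theorem scale_sum_word {ι : Type*} (t : ℝ) (s : Finset ι)
    (c : ι → ℝ) (l : ι → List (ℕ × W)) : scale t (∑ w ∈ s, c w • word (l w)) =
      ∑ w ∈ s, (t ^ (l w).length * c w) • word (l w) := by
  rw [map_sum]
  refine Finset.sum_congr rfl fun w _ => ?_
  rw [map_smul, scale_word, smul_smul, mul_comm]

theorem sum_coord_smul {ι V' : Type*} [Fintype ι] [AddCommGroup V'] [Module ℝ V']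
    (b : Module.Basis ι ℝ W) (f : W →ₗ[ℝ] V') (w : W) : ∑ i, b.coord i w • f (b i) = f w := by
  conv_rhs => rw [← b.sum_repr w, map_sum]
  simp

/-- The operator `δ h + h δ`, completed by the derivation counting antighosts `c^{(1)}` in the
complement of the range of `T`, multiplies a word by its length. -/
theorem euler_word {ι : Type*} [Fintype ι] (e : Module.Basis ι ℝ W) (T : W →ₗ[ℝ] W)
    (hT : ∀ w, T (T w) = T w) (p : Module.Dual ℝ W) (l : List (ℕ × W)) :
    delta T p (homotopy T (word l)) + homotopy T (delta T p (word l)) +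
      ∑ i, gen 0 (e i - T (e i)) * contr T (e.coord i) (word l) = (l.length : ℝ) • word l := by
  induction l with
  | nil =>
    simp [delta_one, (isOddDerivation_homotopy T).map_one, (isOddDerivation_contr T _).map_one]
  | cons x l ih =>
    obtain ⟨k, w⟩ := x
    have hsum : ∀ w : W, ∑ i, e.coord i w • (e i - T (e i)) = w - T w :=
      sum_coord_smul e (LinearMap.id - T)
    -- On a generator the pairings give back one of the two components `T w` and `w - T w` each; for
    -- `c⁽¹⁾` the component `w - T w` comes from the contraction sum instead.
    have hgen : delta T p (homotopy T (gen k w)) + homotopy T (delta T p (gen k w)) +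
        ∑ i, gen 0 (e i - T (e i)) * contr T (e.coord i) (gen k w) = gen k w := by
      rw [homotopy_gen, delta_gen]
      match k with
      | 0 =>
        have h1 : ∑ i, gen 0 (e i - T (e i)) * contr T (e.coord i) (gen 0 w) =
            gen 0 (w - T w) := by
          have h3 : (w - T w) - T (w - T w) = w - T w := by simp [hT]
          rw [← h3, ← hsum (w - T w), map_sum]
          refine Finset.sum_congr rfl fun i _ => ?_
          rw [contr_gen_zero, map_smul, ← Algebra.commutes, ← Algebra.smul_def]
        have h2 : homotopy T (algebraMap ℝ _ (p (w - T w))) = 0 := by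
          rw [Algebra.algebraMap_eq_smul_one, map_smul, (isOddDerivation_homotopy T).map_one,
            smul_zero]
        rw [h1]
        simp only [deltaGen, homotopyGen, LinearMap.comp_apply, Algebra.linearMap_apply,
          LinearMap.sub_apply, LinearMap.id_apply]
        rw [h2]
        simp [delta_gen, deltaGen, hT]
      | k + 1 =>
        simp only [contr_gen_succ, mul_zero, Finset.sum_const_zero, add_zero]
        by_cases h : Even k <;>
          simp [deltaGen, homotopyGen, delta_gen, homotopy_gen, h, Nat.even_add_one, hT]
    -- The contraction passes `gen k w` with the sign `(-1) ^ (k + 1)`, and the odd generator `gen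
    -- 0` passes it with the same sign, so each summand is an even derivation.
    have hc : ∀ i, gen 0 (e i - T (e i)) * contr T (e.coord i) (gen k w * word l) =
        gen 0 (e i - T (e i)) * contr T (e.coord i) (gen k w) * word l +
        gen k w * (gen 0 (e i - T (e i)) * contr T (e.coord i) (word l)) := by
      intro i
      rw [(isOddDerivation_contr T _).gen_mul, mul_add, mul_assoc, mul_smul_comm,
        ← mul_assoc (gen 0 _) (gen k w), gen_comm 0 k, smul_mul_assoc, smul_smul, zero_add, one_mul,
        ← pow_add, Even.neg_one_pow (Even.add_self _), one_smul, mul_assoc]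
    rw [word_cons]
    simp only [hc]
    rw [delta_mul T p (gen k w), isOddDerivation_homotopy T (gen k w), map_add, map_add,
      delta_mul, delta_mul, isOddDerivation_homotopy T (delta T p (gen k w)),
      isOddDerivation_homotopy T (parity (gen k w)), delta_parity, homotopy_parity, parity_parity,
      Finset.sum_add_distrib, ← Finset.sum_mul, ← Finset.mul_sum, List.length_cons]
    -- The mixed terms of `δ h + h δ` cancel because both operators anticommute with `parity`; the
    -- whole operator is an even derivation, which is the identity on generators and so multiplies a
    -- word by its length.
    calc _ = (delta T p (homotopy T (gen k w)) + homotopy T (delta T p (gen k w)) +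
          ∑ i, gen 0 (e i - T (e i)) * contr T (e.coord i) (gen k w)) * word l +
        gen k w * (delta T p (homotopy T (word l)) + homotopy T (delta T p (word l)) +
          ∑ i, gen 0 (e i - T (e i)) * contr T (e.coord i) (word l)) := by
          noncomm_ring
      _ = _ := by
          rw [hgen, ih, mul_smul_comm]
          push_cast
          module

end Fibre

/-! ### Smooth dependence of an integral on parameters. -/

section ParametricIntegral

universe u

variable {E : Type u} [NormedAddCommGroup E] [NormedSpace ℝ E] [ProperSpace E]

/-- On a closed ball around `x` inside `U`, compact since `E` is proper, times the interval of
integration, the partial derivative is bounded by a constant, which serves as the dominating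
function. -/
theorem hasFDerivAt_intervalIntegral_of_contDiffOn {F : Type*} [NormedAddCommGroup F]
    [NormedSpace ℝ F] {f : E × ℝ → F} {U : Set E} (hU : IsOpen U)
    (hf : ContDiffOn ℝ ∞ f (U ×ˢ univ)) (a b : ℝ) {x : E} (hx : x ∈ U) :
    HasFDerivAt (fun y => ∫ t in a..b, f (y, t))
      (∫ t in a..b, (fderiv ℝ f (x, t)).comp (ContinuousLinearMap.inl ℝ E ℝ)) x := by
  have hUo : IsOpen (U ×ˢ (univ : Set ℝ)) := hU.prod isOpen_univ
  have hline : ∀ y ∈ U, Continuous fun t => f (y, t) := fun y hy =>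
    hf.continuousOn.comp_continuous (by fun_prop) fun t => ⟨hy, mem_univ t⟩
  have hder : ContinuousOn (fun z => (fderiv ℝ f z).comp (ContinuousLinearMap.inl ℝ E ℝ))
      (U ×ˢ (univ : Set ℝ)) :=
    (hf.continuousOn_fderiv_of_isOpen hUo (by simp)).clm_comp continuousOn_const
  obtain ⟨r, hr, hball⟩ := Metric.nhds_basis_closedBall.mem_iff.1 (hU.mem_nhds hx)
  obtain ⟨C, hC⟩ := ((isCompact_closedBall x r).prod
    (isCompact_uIcc (a := a) (b := b))).exists_bound_of_continuousOn (hder.mono (prod_mono hball (subset_univ _)))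
  refine intervalIntegral.hasFDerivAt_integral_of_dominated_of_fderiv_le (bound := fun _ => C)
    (F' := fun y t => (fderiv ℝ f (y, t)).comp (ContinuousLinearMap.inl ℝ E ℝ))
    (Metric.closedBall_mem_nhds x hr) ?_ ((hline x hx).intervalIntegrable a b) ?_ ?_
    intervalIntegrable_const ?_
  · filter_upwards [hU.mem_nhds hx] with y hy using (hline y hy).aestronglyMeasurable
  · exact (hder.comp_continuous (by fun_prop) fun t => ⟨hx, mem_univ t⟩).aestronglyMeasurable
  · exact .of_forall fun t ht y hy => hC (y, t) ⟨hy, uIoc_subset_uIcc ht⟩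
  · refine .of_forall fun t _ y hy => ?_
    have h1 : HasFDerivAt f (fderiv ℝ f (y, t)) (y, t) :=
      ((hf.contDiffAt (hUo.mem_nhds ⟨hball hy, mem_univ t⟩)).differentiableAt (by simp)).hasFDerivAt
    exact h1.comp y (hasFDerivAt_prodMk_left y t)

theorem contDiffOn_intervalIntegral {F : Type u} [NormedAddCommGroup F] [NormedSpace ℝ F]
    {f : E × ℝ → F} {U : Set E} (hU : IsOpen U) (hf : ContDiffOn ℝ ∞ f (U ×ˢ univ)) (a b : ℝ) :
    ContDiffOn ℝ ∞ (fun y => ∫ t in a..b, f (y, t)) U := by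
  rw [contDiffOn_infty]
  intro n
  -- The derivative is an integral of the same kind with values in `E →L[ℝ] F`. The target must
  -- therefore vary in the induction, and `E` and `F` share a universe so that it can.
  induction n generalizing F with
  | zero =>
    exact contDiffOn_zero.2 fun x hx =>
      (hasFDerivAt_intervalIntegral_of_contDiffOn hU hf a b hx).continuousAt.continuousWithinAt
  | succ n ih =>
    rw [Nat.cast_succ, contDiffOn_succ_iff_fderiv_of_isOpen hU]
    refine ⟨fun x hx => (hasFDerivAt_intervalIntegral_of_contDiffOn hU hf a b
      hx).differentiableAt.differentiableWithinAt, by simp, ?_⟩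
    have h : ContDiffOn ℝ ∞ (fun z => (fderiv ℝ f z).comp (ContinuousLinearMap.inl ℝ E ℝ))
        (U ×ˢ (univ : Set ℝ)) :=
      (hf.fderiv_of_isOpen (hU.prod isOpen_univ) (by simp)).clm_comp contDiffOn_const
    exact (ih h).congr fun x hx => (hasFDerivAt_intervalIntegral_of_contDiffOn hU hf a b hx).fderiv

end ParametricIntegral

/-! ### The contracting homotopy for smooth coefficients on one fibre of the Legendre bundle. -/

section FibreHomotopy

variable {W : Type*} [AddCommGroup W] [Module ℝ W]

/-- The algebra of antighosts carries no topology, so identities between antighost-valued integrals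
are tested against linear functionals, which separate points. -/
theorem eq_zero_of_forall_dual {A : Type*} [AddCommGroup A] [Module ℝ A] {x : A}
    (h : ∀ ℓ : Module.Dual ℝ A, ℓ x = 0) : x = 0 :=
  (Module.forall_dual_apply_eq_zero_iff ℝ x).1 h

theorem eq_of_forall_dual {A : Type*} [AddCommGroup A] [Module ℝ A] {x y : A}
    (h : ∀ ℓ : Module.Dual ℝ A, ℓ x = ℓ y) : x = y :=
  sub_eq_zero.1 (eq_zero_of_forall_dual fun ℓ => by rw [map_sub, h, sub_self])

/-- The covector `p` with its component along the complement of the range of `T` multiplied by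
`t`. -/
def scaleMom (T : W →ₗ[ℝ] W) (t : ℝ) (p : Module.Dual ℝ W) : Module.Dual ℝ W :=
  p ∘ₗ T + t • (p ∘ₗ (LinearMap.id - T))

/-- The components of a covector. -/
def comps {m : ℕ} (e : Fin m → W) (p : Module.Dual ℝ W) : Fin m → ℝ := fun i => p (e i)

theorem scaleMom_apply (T : W →ₗ[ℝ] W) (t : ℝ) (p : Module.Dual ℝ W) (w : W) :
    scaleMom T t p w = p (T w) + t * p (w - T w) := by
  simp [scaleMom]

theorem scaleMom_sub (T : W →ₗ[ℝ] W) (hT : ∀ w, T (T w) = T w) (t : ℝ) (p : Module.Dual ℝ W)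
    (w : W) : scaleMom T t p (w - T w) = t * p (w - T w) := by
  simp [scaleMom_apply, hT]

theorem scaleMom_one (T : W →ₗ[ℝ] W) (p : Module.Dual ℝ W) : scaleMom T 1 p = p := by
  ext w
  simp [scaleMom_apply]

theorem scaleMom_zero (T : W →ₗ[ℝ] W) (p : Module.Dual ℝ W) : scaleMom T 0 p = p ∘ₗ T := by
  ext w
  simp [scaleMom_apply]

variable {m : ℕ} {ι : Type*}

theorem comps_scaleMom (e : Fin m → W) (T : W →ₗ[ℝ] W) (t : ℝ) (p : Module.Dual ℝ W) :
    comps e (scaleMom T t p) =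
      comps e (p ∘ₗ T) + t • comps e (p ∘ₗ (LinearMap.id - T)) := by
  ext i
  simp [comps, scaleMom_apply]

theorem comps_add_smul (e : Fin m → W) (p α : Module.Dual ℝ W) (ε : ℝ) :
    comps e (p + ε • α) = comps e p + ε • comps e α := by
  ext i
  simp [comps]

/-- The contracting homotopy on the fibre of the Legendre bundle, applied to the antighost-valued
function `p ↦ ∑ w ∈ s, G w (comps e p) • word (l w)`. -/
def fibreHomotopy (e : Fin m → W) (T : W →ₗ[ℝ] W) (s : Finset ι) (G : ι → (Fin m → ℝ) → ℝ)
    (l : ι → List (ℕ × W)) (p : Module.Dual ℝ W) : Antighost W :=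
  ∑ w ∈ s, ((∫ t in (0 : ℝ)..1, t ^ ((l w).length - 1) * G w (comps e (scaleMom T t p))) •
      homotopy T (word (l w)) +
    ∑ i, (∫ t in (0 : ℝ)..1, t ^ (l w).length *
        fderiv ℝ (G w) (comps e (scaleMom T t p)) (Pi.single i 1)) •
      (gen 0 (e i - T (e i)) * word (l w)))

/-- The integrand of `fibreHomotopy`. -/
def homotopyIntegrand (e : Fin m → W) (T : W →ₗ[ℝ] W) (s : Finset ι) (G : ι → (Fin m → ℝ) → ℝ)
    (l : ι → List (ℕ × W)) (p : Module.Dual ℝ W) (t : ℝ) : Antighost W :=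
  ∑ w ∈ s, ((t ^ ((l w).length - 1) * G w (comps e (scaleMom T t p))) • homotopy T (word (l w)) +
    ∑ i, (t ^ (l w).length * fderiv ℝ (G w) (comps e (scaleMom T t p)) (Pi.single i 1)) •
      (gen 0 (e i - T (e i)) * word (l w)))

/-- For finite sums with coefficients continuous in `t`, applying a functional and integrating
commute; the homotopy is thereby the weak integral of `homotopyIntegrand`. -/
theorem dual_fibreHomotopy (e : Fin m → W) (T : W →ₗ[ℝ] W) (s : Finset ι)
    (G : ι → (Fin m → ℝ) → ℝ) (hG : ∀ w ∈ s, ContDiff ℝ ∞ (G w))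
    (l : ι → List (ℕ × W)) (p : Module.Dual ℝ W) (ℓ : Module.Dual ℝ (Antighost W)) :
    ℓ (fibreHomotopy e T s G l p) = ∫ t in (0 : ℝ)..1, ℓ (homotopyIntegrand e T s G l p t) := by
  have hc : Continuous fun t => comps e (scaleMom T t p) := by
    simp only [comps_scaleMom]
    fun_prop
  have h1 : ∀ w ∈ s, Continuous fun t : ℝ =>
      t ^ ((l w).length - 1) * G w (comps e (scaleMom T t p)) := fun w hw =>
    (continuous_pow _).mul ((hG w hw).continuous.comp hc)
  have h2 : ∀ w ∈ s, ∀ i, Continuous fun t : ℝ =>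
      t ^ (l w).length * fderiv ℝ (G w) (comps e (scaleMom T t p)) (Pi.single i 1) := fun w hw i =>
    (continuous_pow _).mul ((((hG w hw).continuous_fderiv (by simp)).comp hc).clm_apply
      continuous_const)
  have h3 : ∀ w ∈ s, ∀ i, Continuous fun t : ℝ =>
      (t ^ (l w).length * fderiv ℝ (G w) (comps e (scaleMom T t p)) (Pi.single i 1)) *
        ℓ (gen 0 (e i - T (e i)) * word (l w)) := fun w hw i => (h2 w hw i).mul continuous_const
  simp only [fibreHomotopy, homotopyIntegrand, map_sum, map_add, map_smul, smul_eq_mul]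
  rw [intervalIntegral.integral_finsetSum]
  · refine Finset.sum_congr rfl fun w hw => ?_
    rw [intervalIntegral.integral_add, intervalIntegral.integral_finsetSum,
      intervalIntegral.integral_mul_const]
    · congr 1
      refine Finset.sum_congr rfl fun i _ => ?_
      rw [intervalIntegral.integral_mul_const]
    · exact fun i _ => (h3 w hw i).intervalIntegrable _ _
    · exact ((h1 w hw).mul continuous_const).intervalIntegrable _ _
    · exact (continuous_finsetSum _ fun i _ => h3 w hw i).intervalIntegrable _ _
  · exact fun w hw => (((h1 w hw).mul continuous_const).add
      (continuous_finsetSum _ fun i _ => h3 w hw i)).intervalIntegrable _ _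

/-- The value of a functional on the integrand of the contracting homotopy, in terms of the
antighost-valued function only. -/
def homotopyKernel [FiniteDimensional ℝ W] (T : W →ₗ[ℝ] W) (f : Module.Dual ℝ W → Antighost W)
    (p : Module.Dual ℝ W) (ℓ : Module.Dual ℝ (Antighost W)) (t : ℝ) : ℝ :=
  t⁻¹ * ℓ (homotopy T (scale t (f (scaleMom T t p)))) +
    ∑ j, deriv (fun ε : ℝ => ℓ (gen 0 (Module.finBasis ℝ W j - T (Module.finBasis ℝ W j)) *
      scale t (f (scaleMom T t p + ε • (Module.finBasis ℝ W).coord j)))) 0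

/-- Truncated subtraction makes the exponent wrong for the empty word. This does no harm, since the
odd derivations applied here annihilate the empty word. -/
theorem pow_pred_smul {A : Type*} [AddCommGroup A] [Module ℝ A] {t : ℝ} (n : ℕ) {x : A}
    (hx : n = 0 → x = 0) : t • t ^ (n - 1) • x = t ^ n • x := by
  cases n with
  | zero => simp [hx rfl]
  | succ n => rw [smul_smul, Nat.add_sub_cancel, pow_succ']

theorem fderiv_eq_sum (g : (Fin m → ℝ) →L[ℝ] ℝ) (v : Fin m → ℝ) :
    g v = ∑ i, v i * g (Pi.single i 1) := by
  conv_lhs => rw [← (Pi.basisFun ℝ (Fin m)).sum_repr v]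
  simp

theorem hasDerivAt_comp_line {g : (Fin m → ℝ) → ℝ} (hg : ContDiff ℝ ∞ g) (x v : Fin m → ℝ)
    (t : ℝ) : HasDerivAt (fun ε : ℝ => g (x + ε • v)) (fderiv ℝ g (x + t • v) v) t := by
  have h1 : HasDerivAt (fun ε : ℝ => x + ε • v) v t := by
    simpa using ((hasDerivAt_id t).smul_const v).const_add x
  exact ((hg.differentiable (by simp) _).hasFDerivAt).comp_hasDerivAt t h1

/-- Both terms can be read off from `f` itself: the powers of `t` are produced by `scale`, up to one
division by `t`, and the sum of `∂_i` against `e_i - T e_i` is a trace, which may be computed in any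
basis instead of the frame `e`. -/
theorem dual_homotopyIntegrand [FiniteDimensional ℝ W] (e : Fin m → W) (T : W →ₗ[ℝ] W)
    (s : Finset ι) (G : ι → (Fin m → ℝ) → ℝ) (hG : ∀ w ∈ s, ContDiff ℝ ∞ (G w))
    (l : ι → List (ℕ × W)) {f : Module.Dual ℝ W → Antighost W}
    (hf : ∀ p, f p = ∑ w ∈ s, G w (comps e p) • word (l w)) (p : Module.Dual ℝ W)
    (ℓ : Module.Dual ℝ (Antighost W)) {t : ℝ} (ht : t ≠ 0) :
    ℓ (homotopyIntegrand e T s G l p t) = homotopyKernel T f p ℓ t := by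
  have hscale : ∀ p, scale t (f p) = ∑ w ∈ s, (t ^ (l w).length * G w (comps e p)) • word (l w) :=
    fun p => by rw [hf, scale_sum_word]
  set b := Module.finBasis ℝ W with hb
  have hderiv : ∀ j, deriv (fun ε : ℝ => ℓ (gen 0 (b j - T (b j)) *
      scale t (f (scaleMom T t p + ε • b.coord j)))) 0 =
      ∑ w ∈ s, ∑ i, b.coord j (e i) * (t ^ (l w).length *
        fderiv ℝ (G w) (comps e (scaleMom T t p)) (Pi.single i 1) *
          ℓ (gen 0 (b j - T (b j)) * word (l w))) := by
    intro j
    have h : ∀ w ∈ s, HasDerivAt (fun ε : ℝ => t ^ (l w).length *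
        G w (comps e (scaleMom T t p) + ε • comps e (b.coord j)) *
          ℓ (gen 0 (b j - T (b j)) * word (l w)))
        (∑ i, b.coord j (e i) * (t ^ (l w).length *
        fderiv ℝ (G w) (comps e (scaleMom T t p)) (Pi.single i 1) *
          ℓ (gen 0 (b j - T (b j)) * word (l w)))) 0 := by
      intro w hw
      have := ((hasDerivAt_comp_line (hG w hw) (comps e (scaleMom T t p)) (comps e (b.coord j))
        0).const_mul (t ^ (l w).length)).mul_const (ℓ (gen 0 (b j - T (b j)) * word (l w)))
      refine this.congr_deriv ?_
      rw [zero_smul, add_zero, fderiv_eq_sum, Finset.mul_sum, Finset.sum_mul]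
      refine Finset.sum_congr rfl fun i _ => ?_
      simp only [comps]
      ring
    rw [← (HasDerivAt.fun_sum h).deriv]
    congr 1
    ext ε
    rw [hscale, Finset.mul_sum, map_sum]
    refine Finset.sum_congr rfl fun w _ => ?_
    rw [mul_smul_comm, map_smul, comps_add_smul, smul_eq_mul]
  -- Change of frame: `e i - T (e i)` expanded through the coordinates of `e i` in the auxiliary
  -- basis.
  have hsum : ∀ (i : Fin m) (x : Antighost W), ∑ j, b.coord j (e i) *
      ℓ (gen 0 (b j - T (b j)) * x) = ℓ (gen 0 (e i - T (e i)) * x) := by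
    intro i x
    have h : ∑ j, b.coord j (e i) • (b j - T (b j)) = e i - T (e i) :=
      sum_coord_smul b (LinearMap.id - T) (e i)
    rw [← h, map_sum, Finset.sum_mul, map_sum]
    exact Finset.sum_congr rfl fun j _ => by
      rw [map_smul, smul_mul_assoc, map_smul, smul_eq_mul]
  rw [homotopyKernel, ← hb, Finset.sum_congr rfl fun j _ => hderiv j, hscale, map_sum, map_sum,
    Finset.mul_sum, Finset.sum_comm, ← Finset.sum_add_distrib, homotopyIntegrand, map_sum]
  refine Finset.sum_congr rfl fun w _ => ?_
  rw [map_add, map_sum, map_smul, map_smul, map_smul]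
  congr 1
  · have h : t • t ^ ((l w).length - 1) • homotopy T (word (l w)) =
        t ^ (l w).length • homotopy T (word (l w)) := by
      refine pow_pred_smul _ fun h => ?_
      rw [List.length_eq_zero_iff.1 h, word_nil, (isOddDerivation_homotopy T).map_one]
    have h' := congrArg ℓ h
    simp only [map_smul, smul_eq_mul] at h' ⊢
    rw [mul_right_comm, mul_right_comm (t ^ (l w).length), ← h']
    field_simp
  · rw [Finset.sum_comm]
    refine Finset.sum_congr rfl fun i _ => ?_
    rw [map_smul, ← hsum, smul_eq_mul, Finset.mul_sum]
    exact Finset.sum_congr rfl fun j _ => by ring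

/-- The value of the contracting homotopy does not depend on the representation of the
antighost-valued function. -/
theorem dual_fibreHomotopy_eq_integral_kernel [FiniteDimensional ℝ W] (e : Fin m → W)
    (T : W →ₗ[ℝ] W) (s : Finset ι) (G : ι → (Fin m → ℝ) → ℝ) (hG : ∀ w ∈ s, ContDiff ℝ ∞ (G w))
    (l : ι → List (ℕ × W)) {f : Module.Dual ℝ W → Antighost W}
    (hf : ∀ p, f p = ∑ w ∈ s, G w (comps e p) • word (l w)) (p : Module.Dual ℝ W)
    (ℓ : Module.Dual ℝ (Antighost W)) :
    ℓ (fibreHomotopy e T s G l p) = ∫ t in (0 : ℝ)..1, homotopyKernel T f p ℓ t := by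
  rw [dual_fibreHomotopy e T s G hG]
  refine intervalIntegral.integral_congr_ae (.of_forall fun t ht => ?_)
  -- The integral is over the half-open interval, so `t = 0`, where the kernel divides by zero, does
  -- not occur.
  rw [uIoc_of_le zero_le_one] at ht
  exact dual_homotopyIntegrand e T s G hG l hf p ℓ ht.1.ne'

/-- Apply `euler_word` to trade `δ h` for the length minus `h δ` and the contraction terms. What is
left over assembles into the cycle identity and its derivative in the momentum, both rescaled, and
vanishes; the right-hand side is the `t`-derivative of the scaled function. -/
theorem delta_homotopyIntegrand (e : Module.Basis (Fin m) ℝ W) (T : W →ₗ[ℝ] W)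
    (hT : ∀ w, T (T w) = T w) (s : Finset ι) (G : ι → (Fin m → ℝ) → ℝ)
    (hG : ∀ w ∈ s, ContDiff ℝ ∞ (G w)) (l : ι → List (ℕ × W))
    (hcycle : ∀ p, ∑ w ∈ s, G w (comps e p) • delta T p (word (l w)) = 0)
    (p : Module.Dual ℝ W) {t : ℝ} (ht : t ≠ 0) :
    delta T p (homotopyIntegrand e T s G l p t) =
      ∑ w ∈ s, ((l w).length * t ^ ((l w).length - 1) * G w (comps e (scaleMom T t p)) +
        t ^ (l w).length * fderiv ℝ (G w) (comps e (scaleMom T t p))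
          (comps e (p ∘ₗ (LinearMap.id - T)))) • word (l w) := by
  set c := comps e (scaleMom T t p) with hc
  have hd : ∀ x, scale t (delta T (scaleMom T t p) x) = delta T p (scale t x) :=
    scale_delta T p t _ (scaleMom_sub T hT t p)
  -- The cycle identity at the scaled momentum, transported to `p` by `scale t`; one factor `t` has
  -- to be cancelled.
  have h1 : ∑ w ∈ s, (t ^ ((l w).length - 1) * G w c) • delta T p (word (l w)) = 0 := by
    refine (smul_eq_zero_iff_right ht).1 ?_
    have h := congrArg (scale t) (hcycle (scaleMom T t p))
    rw [map_sum, map_zero] at h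
    rw [← h, Finset.smul_sum]
    refine Finset.sum_congr rfl fun w _ => ?_
    rw [mul_comm, mul_smul, smul_comm t, pow_pred_smul, map_smul, hd, scale_word, map_smul]
    intro h0
    rw [List.length_eq_zero_iff.1 h0, word_nil, delta_one]
  -- The cycle identity holds for all momenta, so it may be differentiated in the direction `e.coord
  -- i`. The product rule gives one term from the coefficient and one from `delta`, the latter being
  -- a contraction.
  have h2 : ∀ i, ∑ w ∈ s, ((t ^ ((l w).length - 1) * G w c) • contr T (e.coord i) (word (l w)) +
      (t ^ (l w).length * fderiv ℝ (G w) c (Pi.single i 1)) • delta T p (word (l w))) = 0 := by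
    intro i
    have h3 : ∑ w ∈ s, (G w c • contr T (e.coord i) (word (l w)) +
        fderiv ℝ (G w) c (Pi.single i 1) • delta T (scaleMom T t p) (word (l w))) = 0 := by
      refine eq_zero_of_forall_dual fun ℓ => ?_
      have hci : comps e (e.coord i) = Pi.single i 1 := by
        ext j
        simp [comps, Finsupp.single_apply, Pi.single_apply, eq_comm]
      have hderiv : HasDerivAt (fun ε : ℝ => ∑ w ∈ s, G w (c + ε • Pi.single i 1) *
          (ℓ (delta T (scaleMom T t p) (word (l w))) + ε * ℓ (contr T (e.coord i) (word (l w)))))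
          (∑ w ∈ s, (fderiv ℝ (G w) c (Pi.single i 1) *
            ℓ (delta T (scaleMom T t p) (word (l w))) +
            G w c * ℓ (contr T (e.coord i) (word (l w))))) 0 := by
        refine HasDerivAt.fun_sum fun w hw => ?_
        refine ((hasDerivAt_comp_line (hG w hw) c (Pi.single i 1) 0).fun_mul
          (((hasDerivAt_id (0 : ℝ)).mul_const (ℓ (contr T (e.coord i) (word (l w))))).const_add
            (ℓ (delta T (scaleMom T t p) (word (l w)))))).congr_deriv ?_
        simp
      have hzero : (fun ε : ℝ => ∑ w ∈ s, G w (c + ε • Pi.single i 1) *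
          (ℓ (delta T (scaleMom T t p) (word (l w))) +
            ε * ℓ (contr T (e.coord i) (word (l w))))) = fun _ => 0 := by
        ext ε
        have h := congrArg ℓ (hcycle (scaleMom T t p + ε • e.coord i))
        rw [comps_add_smul, ← hc, hci, delta_add_smul] at h
        simp only [LinearMap.add_apply, LinearMap.smul_apply, map_sum, map_smul, map_add,
          map_zero, smul_eq_mul] at h
        exact h
      rw [hzero] at hderiv
      rw [← (hderiv.unique (hasDerivAt_const _ _)), map_sum]
      exact Finset.sum_congr rfl fun w _ => by simp [add_comm]
    refine (smul_eq_zero_iff_right ht).1 ?_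
    have h := congrArg (fun x => t • scale t x) h3
    simp only [map_sum, map_zero, smul_zero, Finset.smul_sum] at h
    rw [← h, Finset.smul_sum]
    refine Finset.sum_congr rfl fun w _ => ?_
    rw [map_add, smul_add, smul_add, mul_comm, mul_smul, smul_comm t, pow_pred_smul, map_smul,
      map_smul, hd, smul_comm t (G w c), scale_contr, scale_word, map_smul, map_smul, mul_comm,
      mul_smul]
    intro h0
    rw [List.length_eq_zero_iff.1 h0, word_nil, (isOddDerivation_contr T _).map_one]
  -- Commuting `δ` past the new antighost produces the transverse component of `p`, which turns the
  -- partial derivatives of the coefficient into its derivative along the scaling path.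
  have hgen : ∀ i x, delta T p (gen 0 (e i - T (e i)) * x) =
      p (e i - T (e i)) • x - gen 0 (e i - T (e i)) * delta T p x := by
    intro i x
    have h0 : T (e i - T (e i)) = 0 := by rw [map_sub, hT, sub_self]
    rw [(isOddDerivation_delta T p).gen_mul, delta_gen, deltaGen, LinearMap.comp_apply,
      LinearMap.comp_apply, Algebra.linearMap_apply, LinearMap.sub_apply, LinearMap.id_apply, h0,
      sub_zero, zero_add, pow_one, neg_one_smul, ← sub_eq_add_neg, ← Algebra.smul_def]
  have hterm : ∀ w ∈ s, delta T p ((t ^ ((l w).length - 1) * G w c) • homotopy T (word (l w)) +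
      ∑ i, (t ^ (l w).length * fderiv ℝ (G w) c (Pi.single i 1)) •
        (gen 0 (e i - T (e i)) * word (l w))) =
      ((l w).length * t ^ ((l w).length - 1) * G w c +
        t ^ (l w).length * fderiv ℝ (G w) c (comps e (p ∘ₗ (LinearMap.id - T)))) • word (l w) -
      (homotopy T ((t ^ ((l w).length - 1) * G w c) • delta T p (word (l w))) +
        ∑ i, gen 0 (e i - T (e i)) *
          ((t ^ ((l w).length - 1) * G w c) • contr T (e.coord i) (word (l w)) +
            (t ^ (l w).length * fderiv ℝ (G w) c (Pi.single i 1)) • delta T p (word (l w)))) := by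
    intro w _
    have hE := euler_word e T hT p (l w)
    rw [add_assoc, ← eq_sub_iff_add_eq] at hE
    rw [map_add, map_smul, hE, map_sum, fderiv_eq_sum]
    simp only [map_smul, hgen, mul_add, Finset.sum_add_distrib, smul_sub, Finset.sum_sub_distrib,
      mul_smul_comm, ← Finset.smul_sum, smul_add, add_smul, Finset.mul_sum, Finset.sum_smul, comps,
      LinearMap.comp_apply, LinearMap.sub_apply, LinearMap.id_apply]
    have hs : ∑ i, (t ^ (l w).length * fderiv ℝ (G w) c (Pi.single i 1)) •
        p (e i - T (e i)) • word (l w) =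
        ∑ i, (t ^ (l w).length * (p (e i - T (e i)) * fderiv ℝ (G w) c (Pi.single i 1))) •
          word (l w) :=
      Finset.sum_congr rfl fun i _ => by rw [smul_smul]; congr 1; ring
    rw [hs, smul_smul, mul_comm (t ^ _ * G w c), ← mul_assoc]
    abel
  rw [homotopyIntegrand, map_sum, Finset.sum_congr rfl hterm, Finset.sum_sub_distrib,
    Finset.sum_add_distrib, ← map_sum, h1, map_zero, zero_add, Finset.sum_comm]
  simp only [← Finset.mul_sum, h2, mul_zero, Finset.sum_const_zero, sub_zero]

/-- On cycles, `δ` composed with the contracting homotopy is the identity up to the restriction to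
zero antighosts and to the range of `T`. -/
theorem delta_fibreHomotopy (e : Module.Basis (Fin m) ℝ W) (T : W →ₗ[ℝ] W)
    (hT : ∀ w, T (T w) = T w) (s : Finset ι) (G : ι → (Fin m → ℝ) → ℝ)
    (hG : ∀ w ∈ s, ContDiff ℝ ∞ (G w)) (l : ι → List (ℕ × W))
    (hcycle : ∀ p, ∑ w ∈ s, G w (comps e p) • delta T p (word (l w)) = 0)
    (p : Module.Dual ℝ W) :
    delta T p (fibreHomotopy e T s G l p) =
      ∑ w ∈ s, G w (comps e p) • word (l w) -
        ∑ w ∈ s, (0 ^ (l w).length * G w (comps e (p ∘ₗ T))) • word (l w) := by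
  refine eq_of_forall_dual fun ℓ => ?_
  have h := dual_fibreHomotopy e T s G hG l p (ℓ ∘ₗ delta T p)
  rw [LinearMap.comp_apply] at h
  rw [h]
  set v := comps e (p ∘ₗ (LinearMap.id - T))
  -- A primitive of the integrand: the coefficient at the scaled momentum with its word scaled by
  -- `t`.
  have hderiv : ∀ t : ℝ, HasDerivAt
      (fun t => ∑ w ∈ s, t ^ (l w).length * G w (comps e (scaleMom T t p)) * ℓ (word (l w)))
      (∑ w ∈ s, ((l w).length * t ^ ((l w).length - 1) * G w (comps e (scaleMom T t p)) +
        t ^ (l w).length * fderiv ℝ (G w) (comps e (scaleMom T t p)) v) * ℓ (word (l w))) t := by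
    intro t
    refine HasDerivAt.fun_sum fun w hw => ?_
    simp only [comps_scaleMom]
    exact ((hasDerivAt_pow (l w).length t).mul (hasDerivAt_comp_line (hG w hw) _ v t)).mul_const _
  have hint : ∫ t in (0 : ℝ)..1, (ℓ ∘ₗ delta T p) (homotopyIntegrand e T s G l p t) =
      ∫ t in (0 : ℝ)..1, ∑ w ∈ s, ((l w).length * t ^ ((l w).length - 1) *
        G w (comps e (scaleMom T t p)) +
        t ^ (l w).length * fderiv ℝ (G w) (comps e (scaleMom T t p)) v) * ℓ (word (l w)) := by
    refine intervalIntegral.integral_congr_ae (.of_forall fun t ht => ?_)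
    rw [uIoc_of_le zero_le_one] at ht
    rw [LinearMap.comp_apply, delta_homotopyIntegrand e T hT s G hG l hcycle p ht.1.ne', map_sum]
    simp [v]
  rw [hint, intervalIntegral.integral_eq_sub_of_hasDerivAt fun t _ => hderiv t]
  -- At `t = 1` this is the given function; at `t = 0` the factor `0 ^ length` keeps only the empty
  -- word, evaluated at `p ∘ T`.
  · simp [scaleMom_one, scaleMom_zero]
  · refine Continuous.intervalIntegrable (continuous_finsetSum _ fun w hw => ?_) _ _
    have hc : Continuous fun t => comps e (scaleMom T t p) := by
      simp only [comps_scaleMom]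
      fun_prop
    have h1 := (hG w hw).continuous.comp hc
    have h2 := (((hG w hw).continuous_fderiv (by simp)).comp hc).clm_apply
      (continuous_const (y := v))
    simp only [Function.comp_def] at h1 h2
    fun_prop

end FibreHomotopy

/-! ### Bundle charts and holonomic bases. -/

section Charts

variable {m : ℕ} {Q : Type*} [TopologicalSpace Q] [ChartedSpace (Model m) Q]

instance (q : Q) : FiniteDimensional ℝ (TangentSpace 𝓘(ℝ, Model m) q) :=
  inferInstanceAs (FiniteDimensional ℝ (Model m))

theorem mem_contDiffGroupoid_of_contDiffOn {f : OpenPartialHomeomorph (Model m) (Model m)}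
    (h : ContDiffOn ℝ ∞ f f.source) (h' : ContDiffOn ℝ ∞ f.symm f.target) :
    f ∈ contDiffGroupoid ∞ 𝓘(ℝ, Model m) := by
  rw [contDiffGroupoid, mem_groupoid_of_pregroupoid]
  simp only [contDiffPregroupoid]
  simpa using ⟨h, h'⟩

/-- A local diffeomorphism into the model space is a chart. -/
theorem mem_maximalAtlas_of_contMDiffOn [IsManifold 𝓘(ℝ, Model m) ∞ Q]
    {φ : OpenPartialHomeomorph Q (Model m)}
    (h : ContMDiffOn 𝓘(ℝ, Model m) 𝓘(ℝ, Model m) ∞ φ φ.source)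
    (h' : ContMDiffOn 𝓘(ℝ, Model m) 𝓘(ℝ, Model m) ∞ φ.symm φ.target) :
    φ ∈ IsManifold.maximalAtlas 𝓘(ℝ, Model m) ∞ Q := by
  rw [IsManifold.maximalAtlas, mem_maximalAtlas_iff]
  intro e he
  have he' := IsManifold.subset_maximalAtlas (I := 𝓘(ℝ, Model m)) (n := ∞) he
  have h1 : ContMDiffOn 𝓘(ℝ, Model m) 𝓘(ℝ, Model m) ∞ e e.source :=
    contMDiffOn_of_mem_maximalAtlas he'
  have h2 : ContMDiffOn 𝓘(ℝ, Model m) 𝓘(ℝ, Model m) ∞ e.symm e.target :=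
    contMDiffOn_symm_of_mem_maximalAtlas he'
  have h3 : ContDiffOn ℝ ∞ (φ.symm.trans e) (φ.symm.trans e).source := by
    rw [← contMDiffOn_iff_contDiffOn, OpenPartialHomeomorph.trans_source]
    exact h1.comp (h'.mono inter_subset_left) fun x hx => hx.2
  have h4 : ContDiffOn ℝ ∞ (e.symm.trans φ) (e.symm.trans φ).source := by
    rw [← contMDiffOn_iff_contDiffOn, OpenPartialHomeomorph.trans_source]
    exact h.comp (h2.mono inter_subset_left) fun x hx => hx.2
  constructor
  · refine mem_contDiffGroupoid_of_contDiffOn h3 ?_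
    simpa [OpenPartialHomeomorph.trans_symm_eq_symm_trans_symm] using h4
  · refine mem_contDiffGroupoid_of_contDiffOn h4 ?_
    simpa [OpenPartialHomeomorph.trans_symm_eq_symm_trans_symm] using h3

/-- The total space of a smooth fibre bundle is covered by bundle charts. -/
theorem IsSmoothFibreBundle.exists_isBundleChart [IsManifold 𝓘(ℝ, Model m) ∞ Q]
    {M : Type*} [TopologicalSpace M] [ChartedSpace (Fin m → ℝ) M]
    [IsManifold 𝓘(ℝ, Fin m → ℝ) ∞ M] {τ : Q → ℝ} (hτ : IsSmoothFibreBundle m M τ) (q : Q) :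
    ∃ φ : OpenPartialHomeomorph Q (Model m), IsBundleChart τ φ ∧ q ∈ φ.source := by
  obtain ⟨U, hU, hq, e, hes, het, hefst, he, he'⟩ := hτ (τ q)
  have hqe : q ∈ e.source := by rw [hes]; exact hq
  set c : OpenPartialHomeomorph M (Fin m → ℝ) := chartAt (Fin m → ℝ) (e q).2
  have hc : ContMDiffOn 𝓘(ℝ, Fin m → ℝ) 𝓘(ℝ, Fin m → ℝ) ∞ c c.source := contMDiffOn_chart
  have hc' : ContMDiffOn 𝓘(ℝ, Fin m → ℝ) 𝓘(ℝ, Fin m → ℝ) ∞ c.symm c.target :=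
    contMDiffOn_chart_symm
  -- A chart of the typical fibre times the identity in time, so the first coordinate of the
  -- composite is still `τ`.
  let ψ : OpenPartialHomeomorph (ℝ × M) (Model m) := (OpenPartialHomeomorph.refl ℝ).prod c
  have hψs : ψ.source = univ ×ˢ c.source := rfl
  have hψt : ψ.target = univ ×ˢ c.target := rfl
  have hψ : ContMDiffOn (𝓘(ℝ, ℝ).prod 𝓘(ℝ, Fin m → ℝ)) 𝓘(ℝ, Model m) ∞ ψ ψ.source := by
    have h : ContMDiffOn (𝓘(ℝ, ℝ).prod 𝓘(ℝ, Fin m → ℝ)) 𝓘(ℝ, Fin m → ℝ) ∞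
        (fun x : ℝ × M => c x.2) (univ ×ˢ c.source) :=
      hc.comp contMDiffOn_snd fun x hx => hx.2
    exact contMDiffOn_fst.prodMk_space h
  have hψ' : ContMDiffOn 𝓘(ℝ, Model m) (𝓘(ℝ, ℝ).prod 𝓘(ℝ, Fin m → ℝ)) ∞ ψ.symm ψ.target := by
    have h : ContMDiffOn 𝓘(ℝ, Model m) 𝓘(ℝ, Fin m → ℝ) ∞
        (fun x : Model m => c.symm x.2) (univ ×ˢ c.target) :=
      hc'.comp contDiff_snd.contMDiff.contMDiffOn fun x hx => hx.2
    exact (contDiff_fst.contMDiff.contMDiffOn (I := 𝓘(ℝ, Model m))).prodMk h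
  refine ⟨e.trans ψ, ⟨mem_maximalAtlas_of_contMDiffOn ?_ ?_, fun x hx => ?_⟩, ?_⟩
  · rw [OpenPartialHomeomorph.trans_source]
    exact hψ.comp (he.mono inter_subset_left) fun x hx => hx.2
  · rw [OpenPartialHomeomorph.trans_target]
    exact he'.comp (hψ'.mono inter_subset_left) fun x hx => hx.2
  · rw [OpenPartialHomeomorph.trans_source] at hx
    exact hefst x hx.1
  · rw [OpenPartialHomeomorph.trans_source]
    exact ⟨hqe, mem_univ _, mem_chart_source _ _⟩

variable {τ : Q → ℝ} {φ : OpenPartialHomeomorph Q (Model m)}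

theorem IsBundleChart.mdifferentiable (hφ : IsBundleChart τ φ) :
    φ.MDifferentiable 𝓘(ℝ, Model m) 𝓘(ℝ, Model m) :=
  ⟨(contMDiffOn_of_mem_maximalAtlas hφ.1).mdifferentiableOn (by simp),
    (contMDiffOn_symm_of_mem_maximalAtlas hφ.1).mdifferentiableOn (by simp)⟩

theorem IsBundleChart.mfderiv_eq (hφ : IsBundleChart τ φ) {q : Q} (hq : q ∈ φ.source) :
    mfderiv 𝓘(ℝ, Model m) 𝓘(ℝ, ℝ) τ q = (ContinuousLinearMap.fst ℝ ℝ (Fin m → ℝ)).comp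
      (mfderiv 𝓘(ℝ, Model m) 𝓘(ℝ, Model m) φ q) := by
  have h1 : HasMFDerivAt 𝓘(ℝ, Model m) 𝓘(ℝ, ℝ) (Prod.fst : Model m → ℝ) (φ q)
      (ContinuousLinearMap.fst ℝ ℝ (Fin m → ℝ)) :=
    (ContinuousLinearMap.fst ℝ ℝ (Fin m → ℝ)).hasMFDerivAt
  have h2 := h1.comp q (hφ.mdifferentiable.mdifferentiableAt hq).hasMFDerivAt
  refine (h2.congr_of_eventuallyEq ?_).mfderiv
  filter_upwards [φ.open_source.mem_nhds hq] with x hx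
  exact (hφ.2 x hx).symm

theorem IsBundleChart.mfderiv_fst (hφ : IsBundleChart τ φ) {q : Q} (hq : q ∈ φ.source)
    (v : TangentSpace 𝓘(ℝ, Model m) q) :
    (mfderiv 𝓘(ℝ, Model m) 𝓘(ℝ, Model m) φ q v : Model m).1 =
      (mfderiv 𝓘(ℝ, Model m) 𝓘(ℝ, ℝ) τ q v : ℝ) := by
  rw [hφ.mfderiv_eq hq]
  rfl

theorem IsBundleChart.mfderiv_injective (hφ : IsBundleChart τ φ) {q : Q} (hq : q ∈ φ.source) :
    Function.Injective (mfderiv 𝓘(ℝ, Model m) 𝓘(ℝ, Model m) φ q) :=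
  hφ.mdifferentiable.mfderiv_injective hq

/-- The remaining coordinate, the time component, is zero for vertical vectors. -/
theorem eq_of_coordCovec_eq (hφ : IsBundleChart τ φ) {q : Q} (hq : q ∈ φ.source) {v w : V m τ q}
    (h : ∀ i, coordCovec τ φ i q v = coordCovec τ φ i q w) : v = w := by
  refine Subtype.ext (hφ.mfderiv_injective hq (Prod.ext ?_ (funext h)))
  rw [hφ.mfderiv_fst hq, hφ.mfderiv_fst hq]
  exact (show mfderiv 𝓘(ℝ, Model m) 𝓘(ℝ, ℝ) τ q v.1 = 0 from v.2).trans
    (show mfderiv 𝓘(ℝ, Model m) 𝓘(ℝ, ℝ) τ q w.1 = 0 from w.2).symm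

variable [IsManifold 𝓘(ℝ, Model m) ∞ Q]

theorem coordCovec_coordVec (hφ : IsBundleChart τ φ) {q : Q} (hq : q ∈ φ.source) (i j : Fin m) :
    coordCovec τ φ i q (coordVec τ φ j q) = if i = j then 1 else 0 := by
  change (mfderiv 𝓘(ℝ, Model m) 𝓘(ℝ, Model m) φ q (coordVec τ φ j q).1 : Model m).2 i = _
  rw [mfderiv_coordVec hφ hq j]
  simp [Pi.single_apply]

theorem sum_coordCovec_smul (hφ : IsBundleChart τ φ) {q : Q} (hq : q ∈ φ.source) (v : V m τ q) :
    ∑ i, coordCovec τ φ i q v • coordVec τ φ i q = v := by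
  refine eq_of_coordCovec_eq hφ hq fun j => ?_
  simp [coordCovec_coordVec hφ hq]

/-- The holonomic basis `∂_i` of the vertical tangent space. -/
def coordBasis (hφ : IsBundleChart τ φ) {q : Q} (hq : q ∈ φ.source) :
    Module.Basis (Fin m) ℝ (V m τ q) :=
  .ofEquivFun
    { toFun := fun v i => coordCovec τ φ i q v
      map_add' := fun v w => funext fun i => map_add _ v w
      map_smul' := fun r v => funext fun i => map_smul _ r v
      invFun := fun x => ∑ i, x i • coordVec τ φ i q
      left_inv := fun v => sum_coordCovec_smul hφ hq v
      right_inv := fun x => funext fun j => by simp [coordCovec_coordVec hφ hq] }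

theorem coe_coordBasis (hφ : IsBundleChart τ φ) {q : Q} (hq : q ∈ φ.source) :
    ⇑(coordBasis hφ hq) = fun i => coordVec τ φ i q := by
  ext1 i
  refine eq_of_coordCovec_eq hφ hq fun j => ?_
  simp [coordBasis, coordCovec_coordVec hφ hq, Pi.single_apply]

theorem dual_ext (hφ : IsBundleChart τ φ) {q : Q} (hq : q ∈ φ.source)
    {p p' : Module.Dual ℝ (V m τ q)}
    (h : ∀ i, p (coordVec τ φ i q) = p' (coordVec τ φ i q)) : p = p' :=
  (coordBasis hφ hq).ext fun i => by simpa [coe_coordBasis hφ hq] using h i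

theorem coords_injOn (hφ : IsBundleChart τ φ) {z z' : VStar m τ} (hz : z.q ∈ φ.source)
    (hz' : z'.q ∈ φ.source) (h : coords φ z = coords φ z') : z = z' := by
  obtain ⟨q, p⟩ := z
  obtain ⟨q', p'⟩ := z'
  obtain rfl : q = q' := φ.injOn hz hz' (congrArg Prod.fst h)
  congr 1
  exact dual_ext hφ hz fun i => congrFun (congrArg Prod.snd h) i

/-- The point of the Legendre bundle with given holonomic coordinates. -/
def ofCoords (τ : Q → ℝ) (φ : OpenPartialHomeomorph Q (Model m)) (x : Model m × (Fin m → ℝ)) :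
    VStar m τ :=
  ⟨φ.symm x.1, ∑ i, x.2 i • coordCovec τ φ i (φ.symm x.1)⟩

theorem coords_ofCoords (hφ : IsBundleChart τ φ) {x : Model m × (Fin m → ℝ)}
    (hx : x.1 ∈ φ.target) : coords φ (ofCoords τ φ x) = x := by
  refine Prod.ext (φ.right_inv hx) (funext fun i => ?_)
  have h := fun j => coordCovec_coordVec hφ (φ.map_target hx) j i
  change (∑ j, x.2 j • coordCovec τ φ j (φ.symm x.1) : Module.Dual ℝ (V m τ (φ.symm x.1)))
    (coordVec τ φ i (φ.symm x.1)) = x.2 i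
  rw [LinearMap.sum_apply]
  simp [h]

theorem ofCoords_coords (hφ : IsBundleChart τ φ) {z : VStar m τ} (hz : z.q ∈ φ.source) :
    ofCoords τ φ (coords φ z) = z :=
  coords_injOn hφ (φ.map_target (φ.map_source hz)) hz (coords_ofCoords hφ (φ.map_source hz))

end Charts

/-! ### Smooth functions and BRST functions over a chart -/

section Smooth

variable {m : ℕ} {Q : Type*} [TopologicalSpace Q] [ChartedSpace (Model m) Q] {τ : Q → ℝ}
  {φ : OpenPartialHomeomorph Q (Model m)} {f g : VStar m τ → ℝ}

namespace SmoothOver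

theorem const (r : ℝ) : SmoothOver φ fun _ : VStar m τ => r :=
  ⟨fun _ => r, contDiffOn_const, fun _ _ => rfl⟩

theorem add (hf : SmoothOver φ f) (hg : SmoothOver φ g) : SmoothOver φ fun z => f z + g z := by
  obtain ⟨F, hF, hF'⟩ := hf
  obtain ⟨G, hG, hG'⟩ := hg
  exact ⟨_, hF.add hG, fun z hz => by simp [hF' z hz, hG' z hz]⟩

theorem mul (hf : SmoothOver φ f) (hg : SmoothOver φ g) : SmoothOver φ fun z => f z * g z := by
  obtain ⟨F, hF, hF'⟩ := hf
  obtain ⟨G, hG, hG'⟩ := hg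
  exact ⟨_, hF.mul hG, fun z hz => by simp [hF' z hz, hG' z hz]⟩

theorem sum {ι : Type*} {s : Finset ι} {F : ι → VStar m τ → ℝ} (h : ∀ i ∈ s, SmoothOver φ (F i)) :
    SmoothOver φ fun z => ∑ i ∈ s, F i z := by
  classical
  induction s using Finset.induction_on with
  | empty => simpa using const 0
  | insert i s hi ih =>
    simp only [Finset.sum_insert hi]
    exact (h i (Finset.mem_insert_self i s)).add (ih fun j hj => h j (Finset.mem_insert_of_mem hj))

theorem congr (hf : SmoothOver φ f) (h : ∀ z : VStar m τ, z.q ∈ φ.source → g z = f z) :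
    SmoothOver φ g := by
  obtain ⟨F, hF, hF'⟩ := hf
  exact ⟨F, hF, fun z hz => (h z hz).trans (hF' z hz)⟩

end SmoothOver

theorem SmoothOnChart.contDiffOn [IsManifold 𝓘(ℝ, Model m) ∞ Q] (hφ : IsBundleChart τ φ)
    {f : Q → ℝ} (hf : SmoothOnChart φ f) : ContDiffOn ℝ ∞ (f ∘ φ.symm) φ.target := by
  rw [← contMDiffOn_iff_contDiffOn]
  exact hf.comp (contMDiffOn_symm_of_mem_maximalAtlas hφ.1) fun x hx => φ.map_target hx

theorem smoothOver_momentum (i : Fin m) :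
    SmoothOver φ fun z : VStar m τ => z.p (coordVec τ φ i z.q) :=
  ⟨fun x => x.2 i, by fun_prop, fun _ _ => rfl⟩

theorem monomial_eq_word (w : List (ℕ × Fin m)) (z : VStar m τ) :
    monomial τ φ w z = word (w.map fun x => (x.1, coordVec τ φ x.2 z.q)) := by
  induction w with
  | nil => rfl
  | cons x w ih =>
    rw [List.map_cons, word_cons, ← ih]
    simp [monomial, cLoc]

theorem monomial_cons (x : ℕ × Fin m) (w : List (ℕ × Fin m)) :
    monomial τ φ (x :: w) = cLoc τ φ x.1 x.2 * monomial τ φ w := by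
  simp [monomial]

theorem monomial_append (v w : List (ℕ × Fin m)) :
    monomial τ φ (v ++ w) = monomial τ φ v * monomial τ φ w := by
  simp [monomial]

theorem antighostNumber_append (v w : List (ℕ × Fin m)) :
    antighostNumber (v ++ w) = antighostNumber v + antighostNumber w := by
  simp [antighostNumber]

theorem antighostNumber_cons (x : ℕ × Fin m) (w : List (ℕ × Fin m)) :
    antighostNumber (x :: w) = x.1 + 1 + antighostNumber w := by
  simp [antighostNumber]

theorem antighostNumber_eq_zero {w : List (ℕ × Fin m)} : antighostNumber w = 0 ↔ w = [] := by
  cases w with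
  | nil => simp [antighostNumber]
  | cons x w => simp [antighostNumber_cons]

namespace BRSTOver

variable {k l : ℕ} {F F' : Sections m τ}

theorem congr (h : BRSTOver φ k F) (hF : ∀ z : VStar m τ, z.q ∈ φ.source → F' z = F z) :
    BRSTOver φ k F' := by
  obtain ⟨s, c, hc, hc'⟩ := h
  exact ⟨s, c, hc, fun z hz => (hF z hz).trans (hc' z hz)⟩

theorem sum {ι : Type*} {s : Finset ι} {F : ι → Sections m τ} (h : ∀ i ∈ s, BRSTOver φ k (F i)) :
    BRSTOver φ k (∑ i ∈ s, F i) := by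
  classical
  induction s using Finset.induction_on with
  | empty => simpa using BRSTOver.zero φ k
  | insert i s hi ih =>
    rw [Finset.sum_insert hi]
    exact (h i (Finset.mem_insert_self i s)).add (ih fun j hj => h j (Finset.mem_insert_of_mem hj))

theorem fun_smul (h : BRSTOver φ k F) (hf : SmoothOver φ f) :
    BRSTOver φ k (fun z => f z • F z) := by
  obtain ⟨s, c, hc, hc'⟩ := h
  refine ⟨s, fun w z => f z * c w z, fun w hw => ⟨(hc w hw).1, hf.mul (hc w hw).2⟩, fun z hz => ?_⟩
  simp only [hc' z hz, Finset.smul_sum, mul_smul]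

theorem monomial (w : List (ℕ × Fin m)) :
    BRSTOver φ (antighostNumber w) (monomial τ φ w) :=
  ⟨{w}, fun _ _ => 1, fun _ hv => ⟨by rw [Finset.mem_singleton.1 hv], .const 1⟩,
    fun z _ => by simp⟩

theorem cLoc (n : ℕ) (i : Fin m) : BRSTOver φ (n + 1) (cLoc τ φ n i) := by
  simpa [antighostNumber, KoszulTate.monomial] using monomial (τ := τ) (φ := φ) [(n, i)]

theorem one : BRSTOver φ 0 (1 : Sections m τ) := by
  simpa [antighostNumber, KoszulTate.monomial] using monomial (τ := τ) (φ := φ) []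

theorem mul (h : BRSTOver φ k F) (h' : BRSTOver φ l F') : BRSTOver φ (k + l) (F * F') := by
  obtain ⟨s, c, hc, hF⟩ := h
  obtain ⟨s', c', hc', hF'⟩ := h'
  have hsum : BRSTOver φ (k + l) (∑ v ∈ s, ∑ w ∈ s', fun z =>
      (c v z * c' w z) • KoszulTate.monomial τ φ (v ++ w) z) := by
    refine sum fun v hv => sum fun w hw => ?_
    have h := (monomial (τ := τ) (φ := φ) (v ++ w)).fun_smul ((hc v hv).2.mul (hc' w hw).2)
    rwa [antighostNumber_append, (hc v hv).1, (hc' w hw).1] at h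
  refine hsum.congr fun z hz => ?_
  rw [Pi.mul_apply, hF z hz, hF' z hz, Finset.sum_mul_sum]
  simp only [Finset.sum_apply]
  refine Finset.sum_congr rfl fun v _ => Finset.sum_congr rfl fun w _ => ?_
  rw [smul_mul_smul_comm, monomial_append, Pi.mul_apply]

end BRSTOver

end Smooth

/-! ### Restriction of coefficients to a fibre. -/

section Slice

variable {m : ℕ}

theorem contDiff_slice {E : Type*} [NormedAddCommGroup E] [NormedSpace ℝ E]
    {G : E × (Fin m → ℝ) → ℝ} {U : Set E} (hG : ContDiffOn ℝ ∞ G (U ×ˢ univ)) {x : E}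
    (hx : x ∈ U) : ContDiff ℝ ∞ fun y => G (x, y) := by
  rw [← contDiffOn_univ]
  exact hG.comp (by fun_prop) fun y _ => ⟨hx, mem_univ y⟩

/-- Identifies the fibre derivative in the homotopy with a partial derivative of the full
coefficient, which is smooth in the base coordinates as well. -/
theorem fderiv_slice {E : Type*} [NormedAddCommGroup E] [NormedSpace ℝ E]
    {G : E × (Fin m → ℝ) → ℝ} {U : Set E} (hU : IsOpen U) (hG : ContDiffOn ℝ ∞ G (U ×ˢ univ))
    {x : E} (hx : x ∈ U) (y v : Fin m → ℝ) :
    fderiv ℝ (fun y => G (x, y)) y v = fderiv ℝ G (x, y) (0, v) := by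
  have h1 : HasFDerivAt G (fderiv ℝ G (x, y)) (x, y) :=
    ((hG.contDiffAt ((hU.prod isOpen_univ).mem_nhds ⟨hx, mem_univ y⟩)).differentiableAt
      (by simp)).hasFDerivAt
  have h2 := h1.comp y (hasFDerivAt_prodMk_right x y)
  rw [show (fun y => G (x, y)) = G ∘ fun y => (x, y) from rfl, h2.fderiv]
  rfl

end Slice

/-! ### The projector `σ ∘ a`, the differential and the homotopy on sections. -/

section Projector

variable {m : ℕ} {Q : Type*} [TopologicalSpace Q] [ChartedSpace (Model m) Q]
  {τ : Q → ℝ} {φ : OpenPartialHomeomorph Q (Model m)}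
  {ℒ : ∀ q, J1 m τ q → ℝ} {a : ∀ q, V m τ q →ₗ[ℝ] Module.Dual ℝ (V m τ q)}
  {σ : ∀ q, Module.Dual ℝ (V m τ q) →ₗ[ℝ] V m τ q}

/-- The components `a_{ij} σ^{jk}` of the projector `σ ∘ a`. -/
def projCoord (a : ∀ q, V m τ q →ₗ[ℝ] Module.Dual ℝ (V m τ q))
    (σ : ∀ q, Module.Dual ℝ (V m τ q) →ₗ[ℝ] V m τ q) (φ : OpenPartialHomeomorph Q (Model m))
    (i k : Fin m) (q : Q) : ℝ :=
  ∑ j, aCoord a φ i j q * sigmaCoord σ φ j k q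

theorem proj_proj (hσ : IsSigmaZero a σ) (q : Q) (w : V m τ q) :
    (σ q ∘ₗ a q) ((σ q ∘ₗ a q) w) = (σ q ∘ₗ a q) w :=
  congrArg (σ q) (hσ.2.2.1 q w)

theorem ktDelta_apply (F : Sections m τ) (z : VStar m τ) :
    ktDelta a σ F z = delta (σ z.q ∘ₗ a z.q) z.p (F z) := rfl

theorem brstOver_gen_sum (n : ℕ) {c : Fin m → VStar m τ → ℝ} (hc : ∀ k, SmoothOver φ (c k)) :
    BRSTOver φ (n + 1) (fun z : VStar m τ => gen n (∑ k, c k z • coordVec τ φ k z.q)) := by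
  have h : BRSTOver φ (n + 1) (∑ k, fun z => c k z • cLoc τ φ n k z) :=
    BRSTOver.sum fun k _ => (BRSTOver.cLoc n k).fun_smul (hc k)
  refine h.congr fun z _ => ?_
  simp [cLoc]

theorem ktDelta_cLoc_odd (n : ℕ) (z : VStar m τ) (i : Fin m) :
    ktDelta a σ (cLoc τ φ (2 * n + 1) i) z =
      gen (2 * n) ((σ z.q ∘ₗ a z.q) (coordVec τ φ i z.q)) := by
  rw [ktDelta_apply, cLoc, delta_gen, deltaGen, if_pos (even_two_mul n)]
  rfl

theorem ktDelta_cLoc_even (n : ℕ) (z : VStar m τ) (i : Fin m) :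
    ktDelta a σ (cLoc τ φ (2 * n + 2) i) z =
      gen (2 * n + 1) (coordVec τ φ i z.q - (σ z.q ∘ₗ a z.q) (coordVec τ φ i z.q)) := by
  rw [ktDelta_apply, cLoc, delta_gen, deltaGen, if_neg (by simp)]
  rfl

/-! ### The contracting homotopy on sections -/

/-- The contracting homotopy on sections. The defining condition determines its value whenever
the section is a BRST function. -/
def ktHomotopy (a : ∀ q, V m τ q →ₗ[ℝ] Module.Dual ℝ (V m τ q))
    (σ : ∀ q, Module.Dual ℝ (V m τ q) →ₗ[ℝ] V m τ q) (F : Sections m τ) : Sections m τ :=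
  fun z => Classical.epsilon fun y : Antighost (V m τ z.q) =>
    ∀ ℓ : Module.Dual ℝ (Antighost (V m τ z.q)), ℓ y = ∫ t in (0 : ℝ)..1,
      homotopyKernel (σ z.q ∘ₗ a z.q) (fun p => F ⟨z.q, p⟩) z.p ℓ t

/-- Functionals separate points, so the condition under `Classical.epsilon` has at most one
solution, and any solution found in a chart is the value. -/
theorem ktHomotopy_eq {F : Sections m τ} {z : VStar m τ} {y : Antighost (V m τ z.q)}
    (h : ∀ ℓ : Module.Dual ℝ (Antighost (V m τ z.q)), ℓ y = ∫ t in (0 : ℝ)..1,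
      homotopyKernel (σ z.q ∘ₗ a z.q) (fun p => F ⟨z.q, p⟩) z.p ℓ t) :
    ktHomotopy a σ F z = y :=
  eq_of_forall_dual fun ℓ => (Classical.epsilon_spec (p := fun y : Antighost (V m τ z.q) =>
    ∀ ℓ : Module.Dual ℝ (Antighost (V m τ z.q)), ℓ y = ∫ t in (0 : ℝ)..1,
      homotopyKernel (σ z.q ∘ₗ a z.q) (fun p => F ⟨z.q, p⟩) z.p ℓ t) ⟨y, h⟩ ℓ).trans (h ℓ).symm

/-- A BRST function over a chart, as a polynomial in the antighosts with smooth coefficients in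
the holonomic coordinates. -/
theorem BRSTOver.exists_coeff {k : ℕ} {F : Sections m τ} (h : BRSTOver φ k F) :
    ∃ (s : Finset (List (ℕ × Fin m))) (G : List (ℕ × Fin m) → Model m × (Fin m → ℝ) → ℝ),
      (∀ w ∈ s, antighostNumber w = k ∧ ContDiffOn ℝ ∞ (G w) (φ.target ×ˢ univ)) ∧
      ∀ z : VStar m τ, z.q ∈ φ.source →
        F z = ∑ w ∈ s, G w (coords φ z) • KoszulTate.monomial τ φ w z := by
  classical
  obtain ⟨s, c, hc, hF⟩ := h
  choose! G hG hG' using fun w hw => (hc w hw).2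
  exact ⟨s, G, fun w hw => ⟨(hc w hw).1, hG w hw⟩, fun z hz => (hF z hz).trans
    (Finset.sum_congr rfl fun w hw => by rw [hG' w hw z hz])⟩

/-- Every local representation of `F` computes the same chart-free value; thus smoothness can be
checked chart by chart. -/
theorem ktHomotopy_eq_fibreHomotopy {F : Sections m τ} {s : Finset (List (ℕ × Fin m))}
    {G : List (ℕ × Fin m) → Model m × (Fin m → ℝ) → ℝ}
    (hG : ∀ w ∈ s, ContDiffOn ℝ ∞ (G w) (φ.target ×ˢ univ))
    (hF : ∀ z : VStar m τ, z.q ∈ φ.source →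
      F z = ∑ w ∈ s, G w (coords φ z) • monomial τ φ w z) {z : VStar m τ} (hz : z.q ∈ φ.source) :
    ktHomotopy a σ F z = fibreHomotopy (fun i => coordVec τ φ i z.q) (σ z.q ∘ₗ a z.q) s
      (fun w y => G w (φ z.q, y)) (fun w => w.map fun x => (x.1, coordVec τ φ x.2 z.q)) z.p := by
  refine ktHomotopy_eq fun ℓ => dual_fibreHomotopy_eq_integral_kernel _ _ s _
    (fun w hw => contDiff_slice (hG w hw) (φ.map_source hz)) _ (fun p => ?_) z.p ℓ
  rw [hF ⟨z.q, p⟩ hz]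
  simp only [monomial_eq_word]
  rfl

variable [IsManifold 𝓘(ℝ, Model m) ∞ Q]

/-- The symmetry of `σ` moves it onto the covector `dq^k`, which gives the index order `a_{ij}
σ^{jk}`. -/
theorem proj_coordVec (hφ : IsBundleChart τ φ) (hσ : IsSigmaZero a σ) {q : Q} (hq : q ∈ φ.source)
    (i : Fin m) :
    (σ q ∘ₗ a q) (coordVec τ φ i q) = ∑ k, projCoord a σ φ i k q • coordVec τ φ k q := by
  refine eq_of_coordCovec_eq hφ hq fun k => ?_
  rw [LinearMap.comp_apply, hσ.1, ← sum_coordCovec_smul hφ hq (σ q (coordCovec τ φ k q))]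
  simp [coordCovec_coordVec hφ hq, projCoord, aCoord, sigmaCoord, mul_comm]

theorem compl_coordVec (hφ : IsBundleChart τ φ) (hσ : IsSigmaZero a σ) {q : Q}
    (hq : q ∈ φ.source) (i : Fin m) :
    coordVec τ φ i q - (σ q ∘ₗ a q) (coordVec τ φ i q) =
      ∑ k, ((if i = k then 1 else 0) - projCoord a σ φ i k q) • coordVec τ φ k q := by
  rw [proj_coordVec hφ hσ hq]
  simp [sub_smul, Finset.sum_sub_distrib]

theorem contDiffOn_projCoord (hφ : IsBundleChart τ φ) (hL : IsQuadraticLagrangian τ ℒ a)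
    (hσ : IsSigmaZero a σ) (i k : Fin m) :
    ContDiffOn ℝ ∞ (fun x => projCoord a σ φ i k (φ.symm x)) φ.target :=
  ContDiffOn.sum fun j _ => (((hL.2 φ hφ).1 i j).contDiffOn hφ).mul
    ((hσ.2.1 φ hφ j k).contDiffOn hφ)

theorem smoothOver_projCoord (hφ : IsBundleChart τ φ) (hL : IsQuadraticLagrangian τ ℒ a)
    (hσ : IsSigmaZero a σ) (i k : Fin m) :
    SmoothOver φ fun z : VStar m τ => projCoord a σ φ i k z.q :=
  ⟨fun x => projCoord a σ φ i k (φ.symm x.1),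
    (contDiffOn_projCoord hφ hL hσ i k).comp contDiffOn_fst fun x hx => hx.1,
    fun z hz => by simp [coords, φ.left_inv hz]⟩

/-! ### The Koszul–Tate differential and the homotopy on local BRST functions -/

theorem brstOver_gen_proj (hφ : IsBundleChart τ φ) (hL : IsQuadraticLagrangian τ ℒ a)
    (hσ : IsSigmaZero a σ) (n : ℕ) (i : Fin m) :
    BRSTOver φ (n + 1) (fun z : VStar m τ => gen n ((σ z.q ∘ₗ a z.q) (coordVec τ φ i z.q))) :=
  (brstOver_gen_sum n (smoothOver_projCoord hφ hL hσ i)).congr fun z hz => by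
    rw [proj_coordVec hφ hσ hz]

theorem brstOver_gen_compl (hφ : IsBundleChart τ φ) (hL : IsQuadraticLagrangian τ ℒ a)
    (hσ : IsSigmaZero a σ) (n : ℕ) (i : Fin m) :
    BRSTOver φ (n + 1) (fun z : VStar m τ =>
      gen n (coordVec τ φ i z.q - (σ z.q ∘ₗ a z.q) (coordVec τ φ i z.q))) :=
  (brstOver_gen_sum n fun k => ((SmoothOver.const (if i = k then 1 else 0)).add
      ((SmoothOver.const (-1)).mul (smoothOver_projCoord hφ hL hσ i k)))).congr fun z hz => by
    rw [compl_coordVec hφ hσ hz]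
    simp [sub_eq_add_neg]

theorem ktDelta_cLoc_zero (hφ : IsBundleChart τ φ) (hσ : IsSigmaZero a σ) {z : VStar m τ}
    (hz : z.q ∈ φ.source) (i : Fin m) : ktDelta a σ (cLoc τ φ 0 i) z = algebraMap ℝ _
      (∑ k, ((if i = k then 1 else 0) - projCoord a σ φ i k z.q) * z.p (coordVec τ φ k z.q)) := by
  rw [ktDelta_apply, cLoc, delta_gen, deltaGen, LinearMap.comp_apply, LinearMap.comp_apply,
    LinearMap.sub_apply, LinearMap.id_apply, compl_coordVec hφ hσ hz, map_sum,
    Algebra.linearMap_apply]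
  simp only [map_smul, smul_eq_mul]

theorem brstOver_ktDelta_cLoc (hφ : IsBundleChart τ φ) (hL : IsQuadraticLagrangian τ ℒ a)
    (hσ : IsSigmaZero a σ) (n : ℕ) (i : Fin m) :
    BRSTOver φ n (ktDelta a σ (cLoc τ φ n i)) := by
  match n with
  | 0 =>
    have h : BRSTOver φ 0 (fun z : VStar m τ =>
        (∑ k, ((if i = k then (1 : ℝ) else 0) + (-1) * projCoord a σ φ i k z.q) *
          z.p (coordVec τ φ k z.q)) • (1 : Sections m τ) z) :=
      BRSTOver.one.fun_smul (.sum fun k _ => ((SmoothOver.const _).add ((SmoothOver.const (-1)).mul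
        (smoothOver_projCoord hφ hL hσ i k))).mul (smoothOver_momentum k))
    refine h.congr fun z hz => ?_
    rw [ktDelta_cLoc_zero hφ hσ hz, Algebra.algebraMap_eq_smul_one]
    simp [sub_eq_add_neg]
  | n + 1 =>
    rcases Nat.even_or_odd' n with ⟨r, rfl | rfl⟩
    · exact (brstOver_gen_proj hφ hL hσ (2 * r) i).congr fun z _ => ktDelta_cLoc_odd r z i
    · exact (brstOver_gen_compl hφ hL hσ (2 * r + 1) i).congr fun z _ => ktDelta_cLoc_even r z i

theorem brstOver_ktDelta_monomial (hφ : IsBundleChart τ φ) (hL : IsQuadraticLagrangian τ ℒ a)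
    (hσ : IsSigmaZero a σ) (w : List (ℕ × Fin m)) :
    BRSTOver φ (antighostNumber w - 1) (ktDelta a σ (monomial τ φ w)) := by
  induction w with
  | nil =>
    refine (BRSTOver.zero φ _).congr fun z _ => ?_
    rw [ktDelta_apply]
    exact delta_one _ _
  | cons x w ih =>
    have h1 := (brstOver_ktDelta_cLoc hφ hL hσ x.1 x.2).mul (BRSTOver.monomial (τ := τ) (φ := φ) w)
    have h2 : BRSTOver φ (x.1 + antighostNumber w)
        ((-1 : ℝ) ^ (x.1 + 1) • (cLoc τ φ x.1 x.2 * ktDelta a σ (monomial τ φ w))) := by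
      -- For the empty word `antighostNumber w - 1` is truncated to `0` and the degrees would not
      -- add up, but there `δ` gives zero.
      rcases eq_or_ne w [] with rfl | hw
      · refine (BRSTOver.zero φ _).congr fun z _ => ?_
        have : delta (σ z.q ∘ₗ a z.q) z.p (monomial τ φ [] z) = 0 := delta_one _ _
        simp [ktDelta_apply, this]
      · have hpos : antighostNumber w ≠ 0 := mt antighostNumber_eq_zero.1 hw
        have h := ((BRSTOver.cLoc (τ := τ) (φ := φ) x.1 x.2).mul ih).smul ((-1 : ℝ) ^ (x.1 + 1))
        rwa [show x.1 + 1 + (antighostNumber w - 1) = x.1 + antighostNumber w by omega] at h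
    have h := h1.add h2
    rw [antighostNumber_cons, show x.1 + 1 + antighostNumber w - 1 = x.1 + antighostNumber w by
      omega]
    refine h.congr fun z _ => ?_
    rw [ktDelta_apply, monomial_cons, Pi.mul_apply]
    exact (isOddDerivation_delta _ _).gen_mul _ _ _

theorem ktDelta_mem_BRST (hL : IsQuadraticLagrangian τ ℒ a) (hσ : IsSigmaZero a σ) {k : ℕ}
    {F : Sections m τ} (hF : F ∈ BRST m τ (k + 1)) : ktDelta a σ F ∈ BRST m τ k := by
  intro φ hφ
  obtain ⟨s, c, hc, hF⟩ := hF φ hφ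
  have h : BRSTOver φ k (∑ w ∈ s, fun z => c w z • ktDelta a σ (monomial τ φ w) z) := by
    refine BRSTOver.sum fun w hw => ?_
    have h := (brstOver_ktDelta_monomial hφ hL hσ w).fun_smul (hc w hw).2
    rwa [(hc w hw).1, Nat.add_sub_cancel] at h
  refine h.congr fun z hz => ?_
  rw [ktDelta_apply, hF z hz, map_sum, Finset.sum_apply]
  exact Finset.sum_congr rfl fun w _ => map_smul _ _ _

theorem brstOver_homotopy_cLoc (hφ : IsBundleChart τ φ) (hL : IsQuadraticLagrangian τ ℒ a)
    (hσ : IsSigmaZero a σ) (n : ℕ) (i : Fin m) :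
    BRSTOver φ (n + 2) (fun z : VStar m τ => homotopy (σ z.q ∘ₗ a z.q) (cLoc τ φ n i z)) := by
  by_cases h : Even n
  · refine (brstOver_gen_proj hφ hL hσ (n + 1) i).congr fun z _ => ?_
    rw [cLoc, homotopy_gen, homotopyGen, if_pos h]
    rfl
  · refine (brstOver_gen_compl hφ hL hσ (n + 1) i).congr fun z _ => ?_
    rw [cLoc, homotopy_gen, homotopyGen, if_neg h]
    rfl

theorem brstOver_homotopy_monomial (hφ : IsBundleChart τ φ) (hL : IsQuadraticLagrangian τ ℒ a)
    (hσ : IsSigmaZero a σ) (w : List (ℕ × Fin m)) :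
    BRSTOver φ (antighostNumber w + 1)
      (fun z : VStar m τ => homotopy (σ z.q ∘ₗ a z.q) (monomial τ φ w z)) := by
  induction w with
  | nil =>
    refine (BRSTOver.zero φ _).congr fun z _ => ?_
    exact (isOddDerivation_homotopy _).map_one
  | cons x w ih =>
    have h1 := (brstOver_homotopy_cLoc hφ hL hσ x.1 x.2).mul
      (BRSTOver.monomial (τ := τ) (φ := φ) w)
    have h2 := ((BRSTOver.cLoc (τ := τ) (φ := φ) x.1 x.2).mul ih).smul ((-1 : ℝ) ^ (x.1 + 1))
    rw [show x.1 + 2 + antighostNumber w = antighostNumber (x :: w) + 1 by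
      rw [antighostNumber_cons]; omega] at h1
    rw [show x.1 + 1 + (antighostNumber w + 1) = antighostNumber (x :: w) + 1 by
      rw [antighostNumber_cons]; omega] at h2
    refine (h1.add h2).congr fun z _ => ?_
    rw [monomial_cons, Pi.mul_apply]
    exact (isOddDerivation_homotopy _).gen_mul _ _ _

/-! ### The contracting homotopy on BRST functions -/

theorem scaleMom_coordVec (hφ : IsBundleChart τ φ) (hσ : IsSigmaZero a σ) {q : Q}
    (hq : q ∈ φ.source) (t : ℝ) (p : Module.Dual ℝ (V m τ q)) (i : Fin m) :
    scaleMom (σ q ∘ₗ a q) t p (coordVec τ φ i q) =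
      ∑ k, (projCoord a σ φ i k q + t * ((if i = k then 1 else 0) - projCoord a σ φ i k q)) *
        p (coordVec τ φ k q) := by
  rw [scaleMom_apply, compl_coordVec hφ hσ hq, proj_coordVec hφ hσ hq]
  simp only [map_sum, map_smul, smul_eq_mul, Finset.mul_sum, ← Finset.sum_add_distrib]
  exact Finset.sum_congr rfl fun k _ => by ring

/-- In coordinates the scaled momentum is smooth in `t` and in the coordinates jointly, being built
from the smooth components of the projector; smoothness of the integral is then
`contDiffOn_intervalIntegral`. -/
theorem smoothOver_integral (hφ : IsBundleChart τ φ) (hL : IsQuadraticLagrangian τ ℒ a)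
    (hσ : IsSigmaZero a σ) {G : Model m × (Fin m → ℝ) → ℝ}
    (hG : ContDiffOn ℝ ∞ G (φ.target ×ˢ univ)) (n : ℕ) :
    SmoothOver φ fun z : VStar m τ => ∫ t in (0 : ℝ)..1, t ^ n *
      G (φ z.q, comps (fun i => coordVec τ φ i z.q) (scaleMom (σ z.q ∘ₗ a z.q) t z.p)) := by
  let R : (Model m × (Fin m → ℝ)) × ℝ → Fin m → ℝ := fun x i =>
    ∑ k, (projCoord a σ φ i k (φ.symm x.1.1) +
      x.2 * ((if i = k then 1 else 0) - projCoord a σ φ i k (φ.symm x.1.1))) * x.1.2 k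
  have hR : ContDiffOn ℝ ∞ R ((φ.target ×ˢ univ) ×ˢ univ) := by
    refine contDiffOn_pi.2 fun i => ContDiffOn.sum fun k _ => ?_
    have h : ContDiffOn ℝ ∞ (fun x : (Model m × (Fin m → ℝ)) × ℝ =>
        projCoord a σ φ i k (φ.symm x.1.1)) ((φ.target ×ˢ univ) ×ˢ univ) :=
      (contDiffOn_projCoord hφ hL hσ i k).comp (by fun_prop) fun x hx => hx.1.1
    fun_prop
  have hint : ContDiffOn ℝ ∞ (fun x : (Model m × (Fin m → ℝ)) × ℝ => x.2 ^ n * G (x.1.1, R x))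
      ((φ.target ×ˢ univ) ×ˢ univ) := by
    have h : ContDiffOn ℝ ∞ (fun x : (Model m × (Fin m → ℝ)) × ℝ => G (x.1.1, R x))
        ((φ.target ×ˢ univ) ×ˢ univ) :=
      hG.comp (ContDiffOn.prodMk (by fun_prop) hR) fun x hx => ⟨hx.1.1, mem_univ _⟩
    exact (contDiff_snd.pow n).contDiffOn.mul h
  refine ⟨_, contDiffOn_intervalIntegral (φ.open_target.prod isOpen_univ) hint 0 1, fun z hz => ?_⟩
  refine intervalIntegral.integral_congr fun t _ => ?_
  have h : comps (fun i => coordVec τ φ i z.q) (scaleMom (σ z.q ∘ₗ a z.q) t z.p) =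
      R (coords φ z, t) := by
    ext i
    rw [comps, scaleMom_coordVec hφ hσ hz]
    simp [R, coords, φ.left_inv hz]
  simp only [h]
  rfl

/-- Each term raises the antighost number by one: `homotopy` shifts one generator upwards, and the
derivative term adds one `c⁽¹⁾`. -/
theorem ktHomotopy_mem_BRST (hL : IsQuadraticLagrangian τ ℒ a) (hσ : IsSigmaZero a σ) {k : ℕ}
    {F : Sections m τ} (hF : F ∈ BRST m τ k) : ktHomotopy a σ F ∈ BRST m τ (k + 1) := by
  intro φ hφ
  obtain ⟨s, G, hG, hF⟩ := (hF φ hφ).exists_coeff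
  have h : BRSTOver φ (k + 1) (∑ w ∈ s, ((fun z : VStar m τ =>
      (∫ t in (0 : ℝ)..1, t ^ (w.length - 1) * G w (φ z.q,
        comps (fun i => coordVec τ φ i z.q) (scaleMom (σ z.q ∘ₗ a z.q) t z.p))) •
        homotopy (σ z.q ∘ₗ a z.q) (monomial τ φ w z)) +
      ∑ i, fun z : VStar m τ => (∫ t in (0 : ℝ)..1, t ^ w.length * fderiv ℝ (G w) (φ z.q,
        comps (fun i => coordVec τ φ i z.q) (scaleMom (σ z.q ∘ₗ a z.q) t z.p))
          (0, Pi.single i 1)) •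
        (gen 0 (coordVec τ φ i z.q - (σ z.q ∘ₗ a z.q) (coordVec τ φ i z.q)) *
          monomial τ φ w z))) := by
    refine BRSTOver.sum fun w hw => BRSTOver.add ?_ (BRSTOver.sum fun i _ => ?_)
    · have h := (brstOver_homotopy_monomial hφ hL hσ w).fun_smul
        (smoothOver_integral hφ hL hσ (hG w hw).2 (w.length - 1))
      rwa [(hG w hw).1] at h
    · have hd : ContDiffOn ℝ ∞ (fun x => fderiv ℝ (G w) x (0, Pi.single i 1))
          (φ.target ×ˢ univ) :=
        ((hG w hw).2.fderiv_of_isOpen (φ.open_target.prod isOpen_univ) (by simp)).clm_apply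
          contDiffOn_const
      have h := ((brstOver_gen_compl hφ hL hσ 0 i).mul
        (BRSTOver.monomial (τ := τ) (φ := φ) w)).fun_smul
          (smoothOver_integral hφ hL hσ hd w.length)
      rw [(hG w hw).1, zero_add, add_comm] at h
      exact h
  refine h.congr fun z hz => ?_
  rw [ktHomotopy_eq_fibreHomotopy (fun w hw => (hG w hw).2) hF hz, fibreHomotopy,
    Finset.sum_apply]
  refine Finset.sum_congr rfl fun w hw => ?_
  rw [Pi.add_apply, Finset.sum_apply, ← monomial_eq_word]
  simp only [List.length_map, fderiv_slice φ.open_target (hG w hw).2 (φ.map_source hz)]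

/-- The differential acts separately at each point of the Legendre bundle, so a global cycle is a
cycle on every fibre and `delta_fibreHomotopy` applies; `scale 0` selects the empty words. -/
theorem ktDelta_ktHomotopy (hφ : IsBundleChart τ φ) (hσ : IsSigmaZero a σ) {k : ℕ}
    {F : Sections m τ} (hF : BRSTOver φ k F) (hcycle : ktDelta a σ F = 0) {z : VStar m τ}
    (hz : z.q ∈ φ.source) : ktDelta a σ (ktHomotopy a σ F) z =
      F z - scale 0 (F ⟨z.q, z.p ∘ₗ (σ z.q ∘ₗ a z.q)⟩) := by
  obtain ⟨s, G, hG, hF⟩ := hF.exists_coeff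
  have hF' : ∀ p : Module.Dual ℝ (V m τ z.q), F ⟨z.q, p⟩ = ∑ w ∈ s,
      G w (φ z.q, comps (coordBasis hφ hz) p) •
        word (w.map fun x => (x.1, coordVec τ φ x.2 z.q)) := by
    intro p
    rw [hF ⟨z.q, p⟩ hz, coe_coordBasis]
    simp only [monomial_eq_word]
    rfl
  have hc : ∀ p : Module.Dual ℝ (V m τ z.q), ∑ w ∈ s, G w (φ z.q, comps (coordBasis hφ hz) p) •
      delta (σ z.q ∘ₗ a z.q) p (word (w.map fun x => (x.1, coordVec τ φ x.2 z.q))) = 0 := by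
    intro p
    have h : delta (σ z.q ∘ₗ a z.q) p (F ⟨z.q, p⟩) = 0 := congrFun hcycle ⟨z.q, p⟩
    rw [hF', map_sum] at h
    rw [← h]
    exact Finset.sum_congr rfl fun w _ => (map_smul _ _ _).symm
  have h := delta_fibreHomotopy (coordBasis hφ hz) (σ z.q ∘ₗ a z.q) (proj_proj hσ z.q) s
    (fun w y => G w (φ z.q, y)) (fun w hw => contDiff_slice (hG w hw).2 (φ.map_source hz)) _ hc z.p
  have hH := ktHomotopy_eq_fibreHomotopy (a := a) (σ := σ) (fun w hw => (hG w hw).2) hF hz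
  rw [coe_coordBasis] at h
  refine (congrArg (delta (σ z.q ∘ₗ a z.q) z.p) hH).trans (h.trans ?_)
  have hF0 := hF' (z.p ∘ₗ (σ z.q ∘ₗ a z.q))
  rw [coe_coordBasis] at hF0
  refine congrArg₂ (· - ·) ?_ ?_
  · rw [← coe_coordBasis hφ hz]
    exact (hF' z.p).symm
  exact ((congrArg (scale (W := V m τ z.q) 0) hF0).trans (scale_sum_word _ _ _ _)).symm

end Projector

/-! ### The constraint space, and BRST functions of antighost number zero. -/

section Constraint

variable {m : ℕ} {Q : Type*} [TopologicalSpace Q] [ChartedSpace (Model m) Q]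
  {τ : Q → ℝ} {φ : OpenPartialHomeomorph Q (Model m)}
  {ℒ : ∀ q, J1 m τ q → ℝ} {a : ∀ q, V m τ q →ₗ[ℝ] Module.Dual ℝ (V m τ q)}
  {σ : ∀ q, Module.Dual ℝ (V m τ q) →ₗ[ℝ] V m τ q}

theorem parity_monomial (w : List (ℕ × Fin m)) (z : VStar m τ) :
    parity (monomial τ φ w z) = (-1 : ℝ) ^ antighostNumber w • monomial τ φ w z := by
  induction w with
  | nil => simp [monomial, antighostNumber]
  | cons x w ih =>
    rw [monomial_cons, Pi.mul_apply, map_mul, ih, antighostNumber_cons, cLoc, parity_gen,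
      smul_mul_smul_comm, ← pow_add]

theorem BRSTOver.parity_apply {k : ℕ} {F : Sections m τ} (hF : BRSTOver φ k F) {z : VStar m τ}
    (hz : z.q ∈ φ.source) : parity (F z) = (-1 : ℝ) ^ k • F z := by
  obtain ⟨s, c, hc, hF⟩ := hF
  rw [hF z hz, map_sum, Finset.smul_sum]
  refine Finset.sum_congr rfl fun w hw => ?_
  rw [map_smul, parity_monomial, (hc w hw).1, smul_comm]

/-- Words of positive antighost number are nonempty, so setting the antighosts to zero kills them.
This removes the error term of the homotopy in positive degree. -/
theorem BRSTOver.scale_zero_apply {k : ℕ} {F : Sections m τ} (hF : BRSTOver φ (k + 1) F)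
    {z : VStar m τ} (hz : z.q ∈ φ.source) : scale 0 (F z) = 0 := by
  obtain ⟨s, c, hc, hF⟩ := hF
  rw [hF z hz]
  simp only [monomial_eq_word]
  rw [scale_sum_word]
  refine Finset.sum_eq_zero fun w hw => ?_
  have hne : w ≠ [] := by
    rintro rfl
    exact absurd (hc [] hw).1 (by simp [antighostNumber])
  rw [List.length_map, zero_pow (by simpa using hne), zero_mul, zero_smul]

theorem scale_zero_of_mem_BRST (hcov : ∀ q, ∃ φ : OpenPartialHomeomorph Q (Model m),
      IsBundleChart τ φ ∧ q ∈ φ.source) {k : ℕ} {F : Sections m τ} (hF : F ∈ BRST m τ (k + 1))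
    (z : VStar m τ) : scale 0 (F z) = 0 :=
  let ⟨φ, hφ, hz⟩ := hcov z.q
  (hF φ hφ).scale_zero_apply hz

theorem counit_ofFun (f : VStar m τ → ℝ) (z : VStar m τ) : counit (ofFun m τ f z) = f z :=
  AlgHom.commutes _ _

theorem scale_ofFun (t : ℝ) (f : VStar m τ → ℝ) (z : VStar m τ) :
    scale t (ofFun m τ f z) = algebraMap ℝ _ (f z) :=
  AlgHom.commutes _ _

theorem ofFun_injective : Function.Injective (ofFun m τ) := fun f g h =>
  funext fun z => by rw [← counit_ofFun f z, h, counit_ofFun]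

theorem ofFun_apply (f : VStar m τ → ℝ) (z : VStar m τ) :
    ofFun m τ f z = f z • (1 : Sections m τ) z :=
  Algebra.algebraMap_eq_smul_one (A := Antighost (V m τ z.q)) (f z)

theorem ktDelta_ofFun (f : VStar m τ → ℝ) : ktDelta a σ (ofFun m τ f) = 0 :=
  funext fun _ => delta_algebraMap _ _ _

/-- The empty word is the only one of antighost number zero, so `counit` recovers the coefficient.
-/
theorem BRSTOver.eq_ofFun {F : Sections m τ} (hF : BRSTOver φ 0 F) :
    SmoothOver φ (fun z => counit (F z)) ∧
      ∀ z : VStar m τ, z.q ∈ φ.source → F z = ofFun m τ (fun z => counit (F z)) z := by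
  obtain ⟨s, c, hc, hF⟩ := hF
  have h : ∀ z : VStar m τ, z.q ∈ φ.source → F z = algebraMap ℝ _ (∑ w ∈ s, c w z) := by
    intro z hz
    rw [hF z hz, map_sum]
    refine Finset.sum_congr rfl fun w hw => ?_
    rw [antighostNumber_eq_zero.1 (hc w hw).1, Algebra.algebraMap_eq_smul_one]
    rfl
  have hcounit : ∀ z : VStar m τ, z.q ∈ φ.source → counit (F z) = ∑ w ∈ s, c w z := fun z hz => by
    rw [h z hz]
    exact AlgHom.commutes _ _
  refine ⟨(SmoothOver.sum fun w hw => (hc w hw).2).congr hcounit, fun z hz => ?_⟩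
  rw [ofFun_apply, hcounit z hz, h z hz, Algebra.algebraMap_eq_smul_one]
  rfl

theorem BRST_zero (hcov : ∀ q, ∃ φ : OpenPartialHomeomorph Q (Model m),
      IsBundleChart τ φ ∧ q ∈ φ.source) :
    BRST m τ 0 = (Subalgebra.toSubmodule (Cinf m τ)).map (ofFun m τ) := by
  ext F
  constructor
  · intro hF
    refine ⟨fun z => counit (F z), fun φ hφ => (hF φ hφ).eq_ofFun.1, funext fun z => ?_⟩
    obtain ⟨φ, hφ, hz⟩ := hcov z.q
    exact ((hF φ hφ).eq_ofFun.2 z hz).symm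
  · rintro ⟨f, hf, rfl⟩ φ hφ
    exact (BRSTOver.one.fun_smul (hf φ hφ)).congr fun z _ => ofFun_apply f z

variable [IsManifold 𝓘(ℝ, Model m) ∞ Q]

/-- The constraint space consists of the covectors fixed by the transposed projector `a ∘ σ`. -/
theorem mem_constraintSpace_iff (hφ : IsBundleChart τ φ) (hL : IsQuadraticLagrangian τ ℒ a)
    (hσ : IsSigmaZero a σ) (h0 : ∀ q, (⟨q, 0⟩ : VStar m τ) ∈ constraintSpace ℒ) {z : VStar m τ}
    (hz : z.q ∈ φ.source) :
    z ∈ constraintSpace ℒ ↔ z.p ∘ₗ (σ z.q ∘ₗ a z.q) = z.p := by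
  obtain ⟨-, b, c, -, -, hℒ⟩ := hL.2 φ hφ
  set A := fun i j => aCoord a φ i j z.q with hA
  have hvel : ∀ (v : J1 m τ z.q) (s : ℝ) (w : V m τ z.q) (i : Fin m),
      vel φ i (v.add (s • w)).1 = vel φ i v.1 + s * coordCovec τ φ i z.q w := by
    intro v s w i
    have h : mfderiv 𝓘(ℝ, Model m) 𝓘(ℝ, Model m) φ z.q (v.add (s • w)).1 =
        mfderiv 𝓘(ℝ, Model m) 𝓘(ℝ, Model m) φ z.q v.1 +
          s • mfderiv 𝓘(ℝ, Model m) 𝓘(ℝ, Model m) φ z.q w.1 := by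
      rw [← map_smul, ← map_add]
      rfl
    exact congrFun (congrArg (fun x : Model m => x.2) h) i
  -- The Legendre map in coordinates, before the symmetry of `a` is used to collect the two halves
  -- of the quadratic term.
  let Λ : J1 m τ z.q → V m τ z.q → ℝ := fun v w =>
    (1 / 2) * ∑ i, ∑ j, A i j * (coordCovec τ φ i z.q w * vel φ j v.1 +
      vel φ i v.1 * coordCovec τ φ j z.q w) + ∑ i, b i z.q * coordCovec τ φ i z.q w
  have hderiv : ∀ (v : J1 m τ z.q) (w : V m τ z.q),
      HasDerivAt (fun s : ℝ => ℒ z.q (v.add (s • w))) (Λ v w) 0 := by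
    intro v w
    simp only [hℒ z.q hz, hvel]
    have hx : ∀ i, HasDerivAt (fun s : ℝ => vel φ i v.1 + s * coordCovec τ φ i z.q w)
        (coordCovec τ φ i z.q w) 0 := fun i => by
      simpa using ((hasDerivAt_id (0 : ℝ)).mul_const (coordCovec τ φ i z.q w)).const_add
        (vel φ i v.1)
    refine (((HasDerivAt.fun_sum fun i _ => HasDerivAt.fun_sum fun j _ =>
      (((hx i).const_mul (aCoord a φ i j z.q)).fun_mul (hx j))).const_mul (1 / 2 : ℝ)).fun_add
      (HasDerivAt.fun_sum fun i _ => (hx i).const_mul (b i z.q))).add_const (c z.q)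
      |>.congr_deriv ?_
    simp only [Λ, hA, zero_mul, add_zero]
    congr 2
    refine Finset.sum_congr rfl fun i _ => Finset.sum_congr rfl fun j _ => ?_
    ring
  have hexp : ∀ u w : V m τ z.q, a z.q u w =
      ∑ i, ∑ j, A i j * (coordCovec τ φ i z.q u * coordCovec τ φ j z.q w) := by
    intro u w
    conv_lhs => rw [← sum_coordCovec_smul hφ hz u, ← sum_coordCovec_smul hφ hz w]
    simp only [map_sum, map_smul, LinearMap.sum_apply, LinearMap.smul_apply, smul_eq_mul,
      Finset.mul_sum]
    rw [Finset.sum_comm]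
    refine Finset.sum_congr rfl fun i _ => Finset.sum_congr rfl fun j _ => ?_
    simp only [hA, aCoord]
    ring
  -- The Legendre map is affine with linear part `a`.
  have hΛ : ∀ (v v' : J1 m τ z.q) (u w : V m τ z.q),
      (∀ i, vel φ i v.1 = vel φ i v'.1 + coordCovec τ φ i z.q u) →
      Λ v w = Λ v' w + a z.q u w := by
    intro v v' u w h
    have h2 : a z.q u w = (1 / 2) * (a z.q w u + a z.q u w) := by
      rw [hL.1 z.q w u]
      ring
    rw [h2, hexp, hexp, ← Finset.sum_add_distrib]
    simp only [Λ, h, ← Finset.sum_add_distrib]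
    rw [add_right_comm, ← mul_add, ← Finset.sum_add_distrib]
    congr 2
    refine Finset.sum_congr rfl fun i _ => ?_
    rw [← Finset.sum_add_distrib]
    exact Finset.sum_congr rfl fun j _ => by ring
  -- The zero section lies in the image, so there is a jet of zero momentum; taken as origin it
  -- makes the Legendre map `v ↦ a (v - v₀)`.
  obtain ⟨v₀, hv₀⟩ := h0 z.q
  have hΛ₀ : ∀ w, Λ v₀ w = 0 := fun w => (hderiv v₀ w).unique (hv₀ w)
  have hadd : ∀ (v : J1 m τ z.q) (u : V m τ z.q) (i : Fin m),
      vel φ i (v.add u).1 = vel φ i v.1 + coordCovec τ φ i z.q u := fun v u i => by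
    simpa using hvel v 1 u i
  constructor
  · rintro ⟨v, hv⟩
    have hu : mfderiv 𝓘(ℝ, Model m) 𝓘(ℝ, ℝ) τ z.q (v.1 - v₀.1) = 0 := by
      rw [map_sub]
      exact sub_eq_zero.2 (v.2.trans v₀.2.symm)
    let u : V m τ z.q := ⟨v.1 - v₀.1, hu⟩
    have hvu : v₀.add u = v := Subtype.ext (add_sub_cancel _ _)
    have hp : ∀ w, z.p w = a z.q u w := by
      intro w
      rw [← (hderiv v w).unique (hv w), hΛ v v₀ u w fun i => by rw [← hadd, hvu], hΛ₀, zero_add]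
    ext w
    rw [LinearMap.comp_apply, LinearMap.comp_apply, hp, hp, hL.1, hσ.2.2.1, hL.1]
  · intro hp
    -- A preimage of `p` is `v₀ + σ p`: by symmetry `a (σ p)` is `p ∘ (σ ∘ a)`, which equals `p` by
    -- assumption.
    refine ⟨v₀.add (σ z.q z.p), fun w => ?_⟩
    have h : z.p w = Λ (v₀.add (σ z.q z.p)) w := by
      rw [hΛ _ v₀ (σ z.q z.p) w (hadd v₀ _), hΛ₀, zero_add, hL.1]
      conv_lhs => rw [← hp]
      exact hσ.1 z.q z.p (a z.q w)
    rw [h]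
    exact hderiv _ w

theorem proj_mem_constraintSpace (hcov : ∀ q, ∃ φ : OpenPartialHomeomorph Q (Model m),
      IsBundleChart τ φ ∧ q ∈ φ.source) (hL : IsQuadraticLagrangian τ ℒ a)
    (hσ : IsSigmaZero a σ) (h0 : ∀ q, (⟨q, 0⟩ : VStar m τ) ∈ constraintSpace ℒ) (z : VStar m τ) :
    (⟨z.q, z.p ∘ₗ (σ z.q ∘ₗ a z.q)⟩ : VStar m τ) ∈ constraintSpace ℒ := by
  obtain ⟨φ, hφ, hz⟩ := hcov z.q
  refine (mem_constraintSpace_iff (z := ⟨z.q, z.p ∘ₗ (σ z.q ∘ₗ a z.q)⟩) hφ hL hσ h0 hz).2 ?_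
  exact LinearMap.ext fun w => congrArg z.p (proj_proj hσ z.q w)

theorem ktDelta_ktHomotopy_eq_self (hcov : ∀ q, ∃ φ : OpenPartialHomeomorph Q (Model m),
      IsBundleChart τ φ ∧ q ∈ φ.source) (hσ : IsSigmaZero a σ) {k : ℕ} {F : Sections m τ}
    (hF : F ∈ BRST m τ k) (hcycle : ktDelta a σ F = 0)
    (h0 : ∀ (q : Q) (p : Module.Dual ℝ (V m τ q)),
      scale 0 (F ⟨q, p ∘ₗ (σ q ∘ₗ a q)⟩) = 0) :
    ktDelta a σ (ktHomotopy a σ F) = F := by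
  funext ⟨q, p⟩
  obtain ⟨φ, hφ, hq⟩ := hcov q
  exact (ktDelta_ktHomotopy (z := ⟨q, p⟩) hφ hσ (hF φ hφ) hcycle hq).trans (sub_eq_self.2 (h0 q p))

/-- A smooth function on the constraint space extends along the projection onto it. -/
theorem exists_cinf_extension (hcov : ∀ q, ∃ φ : OpenPartialHomeomorph Q (Model m),
      IsBundleChart τ φ ∧ q ∈ φ.source) (hL : IsQuadraticLagrangian τ ℒ a)
    (hσ : IsSigmaZero a σ) (h0 : ∀ q, (⟨q, 0⟩ : VStar m τ) ∈ constraintSpace ℒ)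
    (f : CinfOn (constraintSpace ℒ)) :
    ∃ g : Cinf m τ, ∀ z : constraintSpace ℒ, g.1 z.1 = f.1 z := by
  -- The retraction `p ↦ p ∘ (σ ∘ a)`; it is the identity on the constraint space, so the pullback
  -- of `f` extends `f`.
  let ρ : VStar m τ → constraintSpace ℒ := fun z =>
    ⟨_, proj_mem_constraintSpace hcov hL hσ h0 z⟩
  refine ⟨⟨fun z => f.1 (ρ z), fun φ hφ => ?_⟩, fun z => ?_⟩
  · refine ⟨fun x => f.1 (ρ (ofCoords τ φ x)), fun x hx => ?_, fun z hz =>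
      congrArg (fun z => f.1 (ρ z)) (ofCoords_coords hφ hz).symm⟩
    let R : Model m × (Fin m → ℝ) → Model m × (Fin m → ℝ) := fun x =>
      (x.1, fun i => ∑ k, projCoord a σ φ i k (φ.symm x.1) * x.2 k)
    have hR : ContDiffOn ℝ ∞ R (φ.target ×ˢ univ) := by
      refine contDiffOn_fst.prodMk (contDiffOn_pi.2 fun i => ContDiffOn.sum fun k _ => ?_)
      have h : ContDiffOn ℝ ∞ (fun x : Model m × (Fin m → ℝ) => projCoord a σ φ i k (φ.symm x.1))
          (φ.target ×ˢ univ) :=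
        (contDiffOn_projCoord hφ hL hσ i k).comp contDiffOn_fst fun x hx => hx.1
      fun_prop
    have hRρ : ∀ y ∈ φ.target ×ˢ univ, coords φ (ρ (ofCoords τ φ y)).1 = R y := by
      intro y hy
      have hc := coords_ofCoords hφ hy.1
      have hq : (ofCoords τ φ y).q ∈ φ.source := φ.map_target hy.1
      refine Prod.ext (φ.right_inv hy.1) (funext fun i => ?_)
      change (ofCoords τ φ y).p ((σ (ofCoords τ φ y).q ∘ₗ a (ofCoords τ φ y).q)
        (coordVec τ φ i (ofCoords τ φ y).q)) = _
      rw [proj_coordVec hφ hσ hq, map_sum]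
      refine Finset.sum_congr rfl fun k _ => ?_
      rw [map_smul, smul_eq_mul]
      congr 1
      exact congrFun (congrArg Prod.snd hc) k
    -- Near the image point `f` is the restriction of a smooth ambient function `G`, so near `x` the
    -- pullback is `G` composed with the coordinate form `R` of the retraction.
    obtain ⟨O, hO, hxO, G, hG, hfG⟩ := f.2 (ρ (ofCoords τ φ x)) φ hφ (φ.map_target hx.1)
    rw [hRρ x hx] at hxO
    have hUo : IsOpen (φ.target ×ˢ (univ : Set (Fin m → ℝ))) := φ.open_target.prod isOpen_univ
    have hGR : ContDiffAt ℝ ∞ (fun y => G (R y)) x :=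
      (hG.contDiffAt (hO.mem_nhds hxO)).comp x (hR.contDiffAt (hUo.mem_nhds hx))
    refine (hGR.congr_of_eventuallyEq ?_).contDiffWithinAt
    filter_upwards [hUo.mem_nhds hx,
      (hR.continuousOn.continuousAt (hUo.mem_nhds hx)).preimage_mem_nhds (hO.mem_nhds hxO)] with y hy hyO
    rw [← hRρ y hy]
    exact hfG _ (φ.map_target hy.1) (by rw [hRρ y hy]; exact hyO)
  · obtain ⟨φ, hφ, hz⟩ := hcov z.1.q
    have h := (mem_constraintSpace_iff hφ hL hσ h0 hz).1 z.2
    change f.1 (ρ z.1) = f.1 z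
    refine congrArg f.1 (Subtype.ext ?_)
    change (⟨z.1.q, z.1.p ∘ₗ (σ z.1.q ∘ₗ a z.1.q)⟩ : VStar m τ) = z.1
    rw [h]

end Constraint

/-! ### Passage to quotients: functions on `N_L` and the homology in degree zero. -/

section Homology

variable {m : ℕ} {Q : Type*} [TopologicalSpace Q] [ChartedSpace (Model m) Q]
  {τ : Q → ℝ}

theorem mem_vanishingIdeal {N : Set (VStar m τ)} {f : Cinf m τ} :
    f ∈ vanishingIdeal N ↔ ∀ z ∈ N, f.1 z = 0 := Iff.rfl

/-- Restriction of smooth functions to a subset of the Legendre bundle. -/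
def restrict (N : Set (VStar m τ)) : Cinf m τ →ₐ[ℝ] CinfOn N where
  toFun f := ⟨fun z => f.1 z.1, fun z φ hφ hz => by
    obtain ⟨G, hG, hG'⟩ := f.2 φ hφ
    exact ⟨φ.target ×ˢ univ, φ.open_target.prod isOpen_univ, ⟨φ.map_source hz, mem_univ _⟩, G, hG,
      fun w hw _ => hG' w.1 hw⟩⟩
  map_one' := rfl
  map_mul' _ _ := rfl
  map_zero' := rfl
  map_add' _ _ := rfl
  commutes' _ := rfl

theorem ker_restrict (N : Set (VStar m τ)) : RingHom.ker (restrict N) = vanishingIdeal N := by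
  ext f
  rw [RingHom.mem_ker]
  constructor
  · exact fun h z hz => congrFun (congrArg Subtype.val h) ⟨z, hz⟩
  · exact fun h => Subtype.ext (funext fun z => h z.1 z.2)

/-- Functions modulo the vanishing ideal of `N` are the functions on `N`, if all of these extend. -/
theorem exists_quotient_algEquiv {N : Set (VStar m τ)}
    (h : ∀ f : CinfOn N, ∃ g : Cinf m τ, ∀ z : N, g.1 z.1 = f.1 z) :
    ∃ e : (Cinf m τ ⧸ vanishingIdeal N) ≃ₐ[ℝ] CinfOn N,
      ∀ (f : Cinf m τ) (z : N), (e (Ideal.Quotient.mk _ f)).1 z = f.1 z.1 := by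
  have hs : Function.Surjective (restrict N) := fun f => by
    obtain ⟨g, hg⟩ := h f
    exact ⟨g, Subtype.ext (funext hg)⟩
  exact ⟨(Ideal.quotientEquivAlgOfEq ℝ (ker_restrict N).symm).trans
    (Ideal.quotientKerAlgEquivOfSurjective hs), fun f z => rfl⟩

/-- The homology in degree zero, for a differential which vanishes on functions and whose
boundaries are the functions in an ideal `I`. -/
theorem exists_homology_zero_equiv {d : Sections m τ →ₗ[ℝ] Sections m τ} {I : Ideal (Cinf m τ)}
    (hB : BRST m τ 0 = (Subalgebra.toSubmodule (Cinf m τ)).map (ofFun m τ))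
    (hd : ∀ f : VStar m τ → ℝ, d (ofFun m τ f) = 0)
    (hI : ∀ f : Cinf m τ, f ∈ I ↔ ofFun m τ f.1 ∈ boundaries d 0) :
    ∃ e : Homology d 0 ≃ₗ[ℝ] (Cinf m τ ⧸ I),
      ∀ f : Cinf m τ, ∃ hf : ofFun m τ f.1 ∈ cycles d 0,
        e (Submodule.Quotient.mk ⟨ofFun m τ f.1, hf⟩) = Ideal.Quotient.mk _ f := by
  have hmem : ∀ f : Cinf m τ, ofFun m τ f.1 ∈ cycles d 0 := fun f =>
    ⟨hB ▸ ⟨f.1, f.2, rfl⟩, hd f.1⟩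
  let L : Cinf m τ →ₗ[ℝ] cycles d 0 :=
    LinearMap.codRestrict (cycles d 0) (ofFun m τ ∘ₗ (Cinf m τ).val.toLinearMap) hmem
  have hL : Function.Bijective L := by
    constructor
    · intro f g h
      exact Subtype.ext (ofFun_injective (congrArg Subtype.val h))
    · rintro ⟨F, hF⟩
      obtain ⟨f, hf, rfl⟩ := hB ▸ hF.1
      exact ⟨⟨f, hf⟩, rfl⟩
  let u : Cinf m τ ≃ₗ[ℝ] cycles d 0 := LinearEquiv.ofBijective L hL
  let P : cycles d 0 →ₗ[ℝ] Cinf m τ ⧸ I :=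
    (Ideal.Quotient.mkₐ ℝ I).toLinearMap ∘ₗ u.symm.toLinearMap
  have hPu : ∀ f : Cinf m τ, P (L f) = Ideal.Quotient.mk I f := fun f =>
    congrArg (Ideal.Quotient.mk I) (u.symm_apply_apply f)
  have hP : Function.Surjective P := fun y => by
    obtain ⟨f, rfl⟩ := Ideal.Quotient.mk_surjective y
    exact ⟨L f, hPu f⟩
  have hker : (boundaries d 0).submoduleOf (cycles d 0) = LinearMap.ker P := by
    ext F
    obtain ⟨f, rfl⟩ := hL.2 F
    rw [LinearMap.mem_ker, hPu, Ideal.Quotient.eq_zero_iff_mem, hI]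
    rfl
  exact ⟨(Submodule.quotEquivOfEq _ _ hker).trans (P.quotKerEquivOfSurjective hP),
    fun f => ⟨hmem f, hPu f⟩⟩

end Homology

end KoszulTate

end

/-! ### The Koszul–Tate resolution. -/

open KoszulTate in
theorem mainTheorem2 {m : ℕ}
    {M : Type*} [TopologicalSpace M] [ChartedSpace (Fin m → ℝ) M]
    [IsManifold 𝓘(ℝ, Fin m → ℝ) ∞ M]
    {Q : Type*} [TopologicalSpace Q] [T2Space Q] [SecondCountableTopology Q]
    [ChartedSpace (Model m) Q] [IsManifold 𝓘(ℝ, Model m) ∞ Q]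
    (τ : Q → ℝ) (hτ : IsSmoothFibreBundle m M τ)
    (ℒ : ∀ q, J1 m τ q → ℝ) (a : ∀ q, V m τ q →ₗ[ℝ] Module.Dual ℝ (V m τ q))
    (hL : IsQuadraticLagrangian τ ℒ a)
    (r : ℕ) (hr : ∀ q, Module.finrank ℝ (LinearMap.range (a q)) = r)
    (h0 : ∀ q, (⟨q, 0⟩ : VStar m τ) ∈ constraintSpace ℒ)
    (σ : ∀ q, Module.Dual ℝ (V m τ q) →ₗ[ℝ] V m τ q) (hσ : IsSigmaZero a σ) :
    -- the differential is a graded derivation over the smooth functions on the Legendre bundle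
    (∀ f : VStar m τ → ℝ, ktDelta a σ (ofFun m τ f) = 0) ∧
    (∀ k, ∀ f ∈ BRST m τ k, ∀ g : Sections m τ,
      ktDelta a σ (f * g) = ktDelta a σ f * g + (-1 : ℝ) ^ k • (f * ktDelta a σ g)) ∧
    -- its values on the local generators
    (∀ φ, IsBundleChart τ φ → ∀ z : VStar m τ, z.q ∈ φ.source → ∀ i : Fin m,
      ktDelta a σ (cLoc τ φ 0 i) z = algebraMap ℝ _
        (∑ k, ((if i = k then 1 else 0) - ∑ j, aCoord a φ i j z.q * sigmaCoord σ φ j k z.q) *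
          z.p (coordVec τ φ k z.q)) ∧
      (∀ n : ℕ, ktDelta a σ (cLoc τ φ (2 * n + 1) i) z =
        ∑ k, (∑ j, aCoord a φ i j z.q * sigmaCoord σ φ j k z.q) • cLoc τ φ (2 * n) k z) ∧
      (∀ n : ℕ, ktDelta a σ (cLoc τ φ (2 * n + 2) i) z =
        ∑ k, ((if i = k then 1 else 0) - ∑ j, aCoord a φ i j z.q * sigmaCoord σ φ j k z.q) •
          cLoc τ φ (2 * n + 1) k z)) ∧
    -- the complex
    Function.Injective (ofFun m τ) ∧
    BRST m τ 0 = (Subalgebra.toSubmodule (Cinf m τ)).map (ofFun m τ) ∧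
    (∀ k, ∀ f ∈ BRST m τ (k + 1), ktDelta a σ f ∈ BRST m τ k) ∧
    (∀ f : Sections m τ, ktDelta a σ (ktDelta a σ f) = 0) ∧
    -- the higher homology vanishes
    (∀ k, 1 ≤ k → Subsingleton (Homology (ktDelta a σ) k)) ∧
    -- the homology in degree zero
    (∃ e : Homology (ktDelta a σ) 0 ≃ₗ[ℝ] (Cinf m τ ⧸ vanishingIdeal (constraintSpace ℒ)),
      ∀ f : Cinf m τ, ∃ hf : ofFun m τ f.1 ∈ cycles (ktDelta a σ) 0,
        e (Submodule.Quotient.mk ⟨ofFun m τ f.1, hf⟩) = Ideal.Quotient.mk _ f) ∧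
    (∃ e : (Cinf m τ ⧸ vanishingIdeal (constraintSpace ℒ)) ≃ₐ[ℝ] CinfOn (constraintSpace ℒ),
      ∀ (f : Cinf m τ) (z : constraintSpace ℒ),
        (e (Ideal.Quotient.mk _ f)).1 z = f.1 z.1) := by
  have hcov := hτ.exists_isBundleChart
  have hB : BRST m τ 0 = (Subalgebra.toSubmodule (Cinf m τ)).map (ofFun m τ) := BRST_zero hcov
  refine ⟨ktDelta_ofFun, fun k f hf g => funext fun z => ?_, fun φ hφ z hz i =>
    ⟨ktDelta_cLoc_zero hφ hσ hz i, fun n => ?_, fun n => ?_⟩, ofFun_injective, hB,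
    fun k f hf => ktDelta_mem_BRST hL hσ hf, fun f => funext fun z => ?_, fun k hk => ?_,
    exists_homology_zero_equiv hB ktDelta_ofFun fun f => ⟨fun hf => ?_, ?_⟩,
    exists_quotient_algEquiv (exists_cinf_extension hcov hL hσ h0)⟩
  · obtain ⟨φ, hφ, hz⟩ := hcov z.q
    refine (delta_mul _ _ (f z) (g z)).trans ?_
    rw [(hf φ hφ).parity_apply hz, smul_mul_assoc]
    rfl
  · rw [ktDelta_cLoc_odd, proj_coordVec hφ hσ hz, map_sum]
    simp only [map_smul]
    rfl
  · rw [ktDelta_cLoc_even, compl_coordVec hφ hσ hz, map_sum]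
    simp only [map_smul]
    rfl
  · exact delta_delta _ (proj_proj hσ z.q) z.p (f z)
  · obtain ⟨k, rfl⟩ := Nat.exists_eq_add_of_le' hk
    rw [Submodule.Quotient.subsingleton_iff, Submodule.submoduleOf_eq_top]
    rintro F ⟨hF, hF0⟩
    refine ⟨ktHomotopy a σ F, ktHomotopy_mem_BRST hL hσ hF,
      ktDelta_ktHomotopy_eq_self hcov hσ hF hF0 fun q p => ?_⟩
    exact scale_zero_of_mem_BRST hcov hF ⟨q, p ∘ₗ (σ q ∘ₗ a q)⟩
  -- A function vanishing on `N_L` is the boundary of its homotopy: the error term is its value at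
  -- the projected momentum, a point of `N_L`.
  · have hF : ofFun m τ f.1 ∈ BRST m τ 0 := hB ▸ ⟨f.1, f.2, rfl⟩
    refine ⟨ktHomotopy a σ (ofFun m τ f.1), ktHomotopy_mem_BRST hL hσ hF,
      ktDelta_ktHomotopy_eq_self hcov hσ hF (ktDelta_ofFun _) fun q p => ?_⟩
    have h := mem_vanishingIdeal.1 hf _ (proj_mem_constraintSpace hcov hL hσ h0 ⟨q, p⟩)
    exact (scale_ofFun _ _ _).trans ((congrArg _ h).trans (map_zero _))
  -- Conversely, on `N_L` the momentum is fixed by the projector, so `δ c⁽¹⁾` is zero there and a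
  -- boundary has no scalar part.
  · rintro ⟨F, -, hF⟩
    refine mem_vanishingIdeal.2 fun z hz => ?_
    obtain ⟨φ, hφ, hzφ⟩ := hcov z.q
    have h := (mem_constraintSpace_iff hφ hL hσ h0 hzφ).1 hz
    rw [← counit_ofFun f.1 z, ← hF]
    exact counit_delta _ _ (fun w => LinearMap.congr_fun h w) _
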